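/- **Setting.** Let $X_2\hookrightarrow X_1\hookrightarrow\mathcal B_1$ and $X_2\hookrightarrow\mathcal B_2\hookrightarrow\mathcal B_1$ be real Banach spaces with $\|\cdot\|_{\mathcal B_1}\le\|\cdot\|_{X_1}\le\|\cdot\|_{X_2}$, $\|\cdot\|_{\mathcal B_1}\le\|\cdot\|_{\mathcal B_2}\le\|\cdot\|_{X_2}$, such that the closed unit ball of $X_1$ is closed in $\mathcal B_1$. For $(\varepsilon,a,b)\in\mathbb R\times\mathbb R\times X_1$ let $$f(\varepsilon,a,b)=(R(\varepsilon,a,b)-1)\,a+N_1(\varepsilon,a,b),\qquad g(\varepsilon,a,b)=(S(\varepsilon,a,b)-\mathrm{Id})\,b+N_2(\varepsilon,a,b),$$ with $R,N_1$ real valued, $N_2$ valued in $X_2$, $S$ valued in $\mathcal L(\mathcal B_1)\cap\mathcal L(X_1)$, and $(f,g)(\varepsilon,0,0)=0$ for all $\varepsilon$. Let $\mathcal V$ be a neighborhood of the origin in $\mathbb R\times\mathbb R\times X_1$ and $C$ a constant such that, at all points of $\mathcal V$: 1. $R$, $N_1$, $N_2$ (the last with values in $X_2$) are continuous when $b$ is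 measured in $\mathcal B_1$. 2. $|N_1|\le C(|a|+\|b\|_{X_1})^2$ and $\|N_2\|_{X_2}\le C(|a|+\|b\|_{X_1})^2$. With $\delta:=|a-a'|+\|b-b'\|_{\mathcal B_1}$ and $m:=|a|+|a'|+\|b\|_{X_1}+\|b'\|_{X_1}$, $$|N_1(\varepsilon,a,b)-N_1(\varepsilon,a',b')|\le C\,m\,\delta,\qquad \|N_2(\varepsilon,a,b)-N_2(\varepsilon,a',b')\|_{\mathcal B_2}\le C\,m\,\delta.$$ $N_1(\cdot,a,b)$ (in $\mathbb R$) and $N_2(\cdot,a,b)$ (in $\mathcal B_2$) are Lipschitz in $\varepsilon$ with constant $C(|a|+\|b\|_{X_1})^2$. 3. $|R(\varepsilon,a,b)-R(\varepsilon,0,0)|\le C(|a|+\|b\|_{X_1})$; $|R(\varepsilon,a,b)-R(\varepsilon,a',b')|\le C\delta$; and $Q(\varepsilon,a,b):=R(\varepsilon,a,b)-R(\varepsilon,0,0)$ satisfies $|Q(\varepsilon,a,b)-Q(\varepsilon',a,b)|\le C(|\varepsilon|+|\varepsilon'|+|a|+\|b\|_{X_1})|\varepsilon-\varepsilon'|$.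 4. $R(0,0,0)=1$, and $\varepsilon\mapsto R(\varepsilon,0,0)$ is strictly differentiable at $0$ with nonzero derivative $\gamma$ (i.e. $R(\varepsilon,0,0)-\gamma\varepsilon$ has arbitrarily small Lipschitz constant on small neighborhoods of $0$). 5. $\mathrm{Id}-S(\varepsilon,a,b)$ has a right inverse $K(\varepsilon,a,b)$ defined on $X_2$: $(\mathrm{Id}-S)Kx=x$ for $x\in X_2$, with $\|Kx\|_{X_1}\le C\|x\|_{X_2}$, $\|Kx\|_{\mathcal B_1}\le C\|x\|_{\mathcal B_2}$, and for $x\in X_2$ $$\|K(\varepsilon,a,b)x-K(\varepsilon,a,b')x\|_{\mathcal B_1}\le C\|b-b'\|_{\mathcal B_1}\|x\|_{\mathcal B_2},\qquad \|K(\varepsilon,a,b)x-K(\varepsilon',a',b)x\|_{\mathcal B_1}\le C(|\varepsilon-\varepsilon'|+|a-a'|)\|x\|_{X_2}.$$ **Group invariance.** Let $\mathcal E^\varepsilon=\{(a,b)\in\mathbb R\times X_1:(f,g)(\varepsilon,a,b)=0\}$ and $\|(a,b)\|=|a|+\|b\|_{X_1}$. Let $G$ be an $\ell$-dimensional Lie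 group with identity $e_G$ and Lie algebra $\mathcal G$ (with any norm), $\varepsilon_1>0$, and for $|\varepsilon|\le\varepsilon_1$ let $\Phi^\varepsilon:G\times\mathcal E^\varepsilon\to\mathcal E^\varepsilon$ be a group action with $g\mapsto\Phi^\varepsilon(g,\cdot)$ one-to-one, such that: * $\Phi^\varepsilon(\cdot,0,0)$ is differentiable at $e_G$ with derivative $D^\varepsilon$, uniformly in $\varepsilon$: for every neighborhood $\Omega$ of $0\in\mathbb R^\ell$ and every $C^1$ map $\gamma:\Omega\to G$ with $\gamma(0)=e_G$, $\sup_{|\varepsilon|\le\varepsilon_1}|x|^{-1}\|\Phi^\varepsilon(\gamma(x),0,0)-D^\varepsilon\gamma'(0)x\|\to0$ as $x\to0$; * whenever $|\varepsilon|\le\varepsilon_1$ and $(\varepsilon,a,b)\in\mathcal V$, $D^\varepsilon$ is an isomorphism of $\mathcal G$ onto $\{0\}\times(\ker(\mathrm{Id}-S(\varepsilon,a,b))\cap X_1)$; the inverses are bounded uniformly for $|\varepsilon|\le\varepsilon_1$; and $\varepsilon\mapsto D^\varepsilon$ is Lipschitz on $|\varepsilon|\le\varepsilon_1$; * for $g$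 in a neighborhood of $e_G$, $\Phi^\varepsilon(g,\cdot)$ is Lipschitz on the elements of $\mathcal E^\varepsilon$ of small norm, with the neighborhood, the smallness and the Lipschitz constant uniform in $g$ and $\varepsilon$; * there is $\delta_0>0$ such that for all $|\varepsilon|\le\varepsilon_1$ and $(a,b)\in\mathcal E^\varepsilon$ with $\|(a,b)\|<\delta_0$, $\Phi^\varepsilon(\cdot,a,b)$ is continuous on a neighborhood of $e_G$. **Conclusion.** There are $\delta,\eta,r,s>0$ with $r+s<\delta$, a map $B$ with values in $X_1$, and a function $\varepsilon_0:[-r,r]\to(-s,s)$ such that: (a) for $|\varepsilon|+|a|+\|\omega\|_{X_1}<\delta$, $b=B(\varepsilon,a,\omega)$ is the unique solution of $b=\omega+K(\varepsilon,a,b)N_2(\varepsilon,a,b)$ with $\|b\|_{X_1}<\eta$; $B(\varepsilon,0,0)=0$; and $B$ is Lipschitz in $(\varepsilon,a,\omega)$, with $B$ and $\omega$ measured in $\mathcal B_1$; (b) $\varepsilon_0$ is Lipschitz, $\varepsilon_0(0)=0$, $(f,g)(\varepsilon_0(a),a,B(\varepsilon_0(a),a,0))=0$ for $|a|\le r$,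 and for $0<|a|\le r$, $\varepsilon=\varepsilon_0(a)$ is the only solution of $(f,g)(\varepsilon,a,B(\varepsilon,a,0))=0$ with $|\varepsilon|<s$; (c) the branch in (b) is, up to group invariance, the unique solution near the origin other than the trivial one: for every $\tau>0$ there is $\rho>0$ such that whenever $|\varepsilon|+|a|+\|b\|_{X_1}<\rho$ and $(f,g)(\varepsilon,a,b)=0$, either $(a,b)=\Phi^\varepsilon(g,0,0)$ for some $g\in G$, or there are $a'$ with $0<|a'|\le r$, $|a'|<\tau$, $\varepsilon=\varepsilon_0(a')$, and $g\in G$ with $(a,b)=\Phi^\varepsilon\big(g,a',B(\varepsilon_0(a'),a',0)\big)$. -/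

import Mathlib

open Set Filter Topology
open scoped Manifold ContDiff

/-- Four real normed spaces `X₂ ↪ X₁ ↪ B₁` and `X₂ ↪ B₂ ↪ B₁`, the inclusions being injective bounded
linear maps that do not increase norms, such that both composites `X₂ → B₁` agree and the closed
unit ball of `X₁` is closed in `B₁`. -/
structure BanachScale (X₂ X₁ B₂ B₁ : Type*)
    [NormedAddCommGroup X₂] [NormedSpace ℝ X₂] [NormedAddCommGroup X₁] [NormedSpace ℝ X₁]
    [NormedAddCommGroup B₂] [NormedSpace ℝ B₂] [NormedAddCommGroup B₁] [NormedSpace ℝ B₁] where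
  /-- the inclusion `X₂ ↪ X₁` -/
  i : X₂ →L[ℝ] X₁
  /-- the inclusion `X₁ ↪ B₁` -/
  j : X₁ →L[ℝ] B₁
  /-- the inclusion `X₂ ↪ B₂` -/
  k : X₂ →L[ℝ] B₂
  /-- the inclusion `B₂ ↪ B₁` -/
  l : B₂ →L[ℝ] B₁
  comm : ∀ x, j (i x) = l (k x)
  i_injective : Function.Injective i
  j_injective : Function.Injective j
  k_injective : Function.Injective k
  l_injective : Function.Injective l
  norm_i_le : ∀ x, ‖i x‖ ≤ ‖x‖
  norm_j_le : ∀ x, ‖j x‖ ≤ ‖x‖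
  norm_k_le : ∀ x, ‖k x‖ ≤ ‖x‖
  norm_l_le : ∀ x, ‖l x‖ ≤ ‖x‖
  isClosed_ball : IsClosed (j '' Metric.closedBall (0 : X₁) 1)

section

variable {X₂ X₁ B₂ B₁ : Type*}
  [NormedAddCommGroup X₂] [NormedSpace ℝ X₂] [NormedAddCommGroup X₁] [NormedSpace ℝ X₁]
  [NormedAddCommGroup B₂] [NormedSpace ℝ B₂] [NormedAddCommGroup B₁] [NormedSpace ℝ B₁]

/-- Continuity on `V ⊆ ℝ × ℝ × X₁` of a map `F(ε, a, b)` when `b` carries the norm of `B₁`. -/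
def BanachScale.WeakContinuousOn {Y : Type*} [TopologicalSpace Y]
    (E : BanachScale X₂ X₁ B₂ B₁) (V : Set (ℝ × ℝ × X₁)) (F : ℝ → ℝ → X₁ → Y) : Prop :=
  ∀ ε a b, (ε, a, b) ∈ V →
    Tendsto (fun q : ℝ × ℝ × X₁ => F q.1 q.2.1 q.2.2)
      (comap (fun q : ℝ × ℝ × X₁ => (q.1, q.2.1, E.j q.2.2)) (𝓝 (ε, a, E.j b)) ⊓ 𝓟 V)
      (𝓝 (F ε a b))

/-- The data of the discrete dynamical system `â = R(ε,a,b) a + N₁(ε,a,b)`,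
`b̂ = S(ε,a,b) b + N₂(ε,a,b)` with scalar parameter `ε` and scalar `a`; the element `R(ε,a,b)` of
`L(ℝ)` is identified with a real number. `S(ε,a,b)` is a bounded operator on `B₁` (here `SB`)
which restricts to a bounded operator on `X₁` (here `S`). -/
structure DiffSystem (E : BanachScale X₂ X₁ B₂ B₁) where
  R : ℝ → ℝ → X₁ → ℝ
  S : ℝ → ℝ → X₁ → (X₁ →L[ℝ] X₁)
  SB : ℝ → ℝ → X₁ → (B₁ →L[ℝ] B₁)
  S_restrict : ∀ ε a b x, E.j (S ε a b x) = SB ε a b (E.j x)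
  N₁ : ℝ → ℝ → X₁ → ℝ
  N₂ : ℝ → ℝ → X₁ → X₂

namespace DiffSystem

variable {E : BanachScale X₂ X₁ B₂ B₁} (sys : DiffSystem E)

/-- `f(ε,a,b) = (R(ε,a,b) - 1) a + N₁(ε,a,b)`. -/
def f (ε a : ℝ) (b : X₁) : ℝ := (sys.R ε a b - 1) * a + sys.N₁ ε a b

/-- `g(ε,a,b) = (S(ε,a,b) - Id) b + N₂(ε,a,b)`. -/
def g (ε a : ℝ) (b : X₁) : X₁ := (sys.S ε a b b - b) + E.i (sys.N₂ ε a b)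

/-- The set of equilibria `(a, b)` for the parameter value `ε`. -/
def equilibria (ε : ℝ) : Set (ℝ × X₁) := {p | sys.f ε p.1 p.2 = 0 ∧ sys.g ε p.1 p.2 = 0}

/-- `ker (Id - S(ε,a,b)) ∩ X₁`. -/
def kernel (ε a : ℝ) (b : X₁) : Submodule ℝ X₁ :=
  LinearMap.ker (ContinuousLinearMap.id ℝ X₁ - sys.S ε a b).toLinearMap

/-- `(f,g)(ε,0,0) = 0`, and `R`, `N₁`, `N₂` are continuous on `V`, with `b` measured in `B₁`. -/
structure Standing (V : Set (ℝ × ℝ × X₁)) : Prop where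
  f_zero : ∀ ε, sys.f ε 0 0 = 0
  g_zero : ∀ ε, sys.g ε 0 0 = 0
  cont_R : E.WeakContinuousOn V sys.R
  cont_N₁ : E.WeakContinuousOn V sys.N₁
  cont_N₂ : E.WeakContinuousOn V sys.N₂

/-- Bounds on `N₁`; bounds on partial derivatives are in the (weaker) Lipschitz form. -/
structure BoundsN₁ (V : Set (ℝ × ℝ × X₁)) (C : ℝ) : Prop where
  quadratic : ∀ ε a b, (ε, a, b) ∈ V → |sys.N₁ ε a b| ≤ C * (|a| + ‖b‖) ^ 2
  lip_ab : ∀ ε a b a' b', (ε, a, b) ∈ V → (ε, a', b') ∈ V →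
    |sys.N₁ ε a b - sys.N₁ ε a' b'|
      ≤ C * (|a| + |a'| + ‖b‖ + ‖b'‖) * (|a - a'| + ‖E.j (b - b')‖)
  lip_eps : ∀ ε ε' a b, (ε, a, b) ∈ V → (ε', a, b) ∈ V →
    |sys.N₁ ε a b - sys.N₁ ε' a b| ≤ C * (|a| + ‖b‖) ^ 2 * |ε - ε'|

/-- Bounds on `N₂`; bounds on partial derivatives are in the (weaker) Lipschitz form. -/
structure BoundsN₂ (V : Set (ℝ × ℝ × X₁)) (C : ℝ) : Prop where
  quadratic : ∀ ε a b, (ε, a, b) ∈ V → ‖sys.N₂ ε a b‖ ≤ C * (|a| + ‖b‖) ^ 2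
  lip_ab : ∀ ε a b a' b', (ε, a, b) ∈ V → (ε, a', b') ∈ V →
    ‖E.k (sys.N₂ ε a b - sys.N₂ ε a' b')‖
      ≤ C * (|a| + |a'| + ‖b‖ + ‖b'‖) * (|a - a'| + ‖E.j (b - b')‖)
  lip_eps : ∀ ε ε' a b, (ε, a, b) ∈ V → (ε', a, b) ∈ V →
    ‖E.k (sys.N₂ ε a b - sys.N₂ ε' a b)‖ ≤ C * (|a| + ‖b‖) ^ 2 * |ε - ε'|

/-- Bounds on `R`, again with derivative bounds in Lipschitz form. -/
structure BoundsR (V : Set (ℝ × ℝ × X₁)) (C : ℝ) : Prop where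
  bound : ∀ ε a b, (ε, a, b) ∈ V → |sys.R ε a b - sys.R ε 0 0| ≤ C * (|a| + ‖b‖)
  lip_ab : ∀ ε a b a' b', (ε, a, b) ∈ V → (ε, a', b') ∈ V →
    |sys.R ε a b - sys.R ε a' b'| ≤ C * (|a - a'| + ‖E.j (b - b')‖)
  lip_eps : ∀ ε ε' a b, (ε, a, b) ∈ V → (ε', a, b) ∈ V →
    |(sys.R ε a b - sys.R ε 0 0) - (sys.R ε' a b - sys.R ε' 0 0)|
      ≤ C * (|ε| + |ε'| + |a| + ‖b‖) * |ε - ε'|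

/-- Simple crossing: `R(0,0,0) = 1` and `ε ↦ R(ε,0,0)` is strictly differentiable at `0` (that is,
`R(ε,0,0) - 1 - γ ε` has arbitrarily small Lipschitz constant near `0`), with derivative `γ ≠ 0`. -/
def SimpleCrossing : Prop :=
  sys.R 0 0 0 = 1 ∧ ∃ γ : ℝ, γ ≠ 0 ∧ HasStrictDerivAt (fun ε => sys.R ε 0 0) γ 0

/-- `K(ε,a,b)`, for `(ε,a,b) ∈ V`, is a right inverse on `X₂` of `Id - S(ε,a,b)`; it is bounded
`X₂ → X₁` (this is part of its type) and in `L(B₂,B₁)` norm. -/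
structure IsRightInverse (V : Set (ℝ × ℝ × X₁)) (K : ℝ → ℝ → X₁ → (X₂ →L[ℝ] X₁)) : Prop where
  right_inv : ∀ ε a b, (ε, a, b) ∈ V → ∀ x, K ε a b x - sys.S ε a b (K ε a b x) = E.i x
  bounded : ∀ ε a b, (ε, a, b) ∈ V → ∃ C : ℝ, ∀ x, ‖E.j (K ε a b x)‖ ≤ C * ‖E.k x‖

/-- `𝒯(ε,a,b,w) = w + (Id - S(ε,a,b))⁻¹ N₂(ε,a,b)`. -/
def T (K : ℝ → ℝ → X₁ → (X₂ →L[ℝ] X₁)) (ε a : ℝ) (b w : X₁) : X₁ :=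
  w + K ε a b (sys.N₂ ε a b)

/-- `B` is the reduction map: for small `(ε,a,w)`, `B(ε,a,w)` is the unique fixed point of
`𝒯(ε,a,·,w)` in a fixed small ball of `X₁`; `B(ε,0,0) = 0`; and `B` is Lipschitz in the norm
of `B₁`. -/
def IsReduction (K : ℝ → ℝ → X₁ → (X₂ →L[ℝ] X₁)) (B : ℝ → ℝ → X₁ → X₁) (δ η : ℝ) : Prop :=
  (∀ ε a w, |ε| + |a| + ‖w‖ < δ →
    ‖B ε a w‖ < η ∧ sys.T K ε a (B ε a w) w = B ε a w ∧
      ∀ b, ‖b‖ < η → sys.T K ε a b w = b → b = B ε a w) ∧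
  (∀ ε, |ε| < δ → B ε 0 0 = 0) ∧
  ∃ L : ℝ, ∀ ε a w ε' a' w', |ε| + |a| + ‖w‖ < δ → |ε'| + |a'| + ‖w'‖ < δ →
    ‖E.j (B ε a w - B ε' a' w')‖ ≤ L * (|ε - ε'| + |a - a'| + ‖E.j (w - w')‖)

/-- `a ↦ (e a, a, B(e a, a, 0))`, `|a| ≤ r`, is the branch of equilibria determined by `w ≡ 0`:
`e` is Lipschitz, `e 0 = 0`, and for `0 < |a| ≤ r` the number `e a` is the only `ε` with `|ε| < s`
such that `(ε, a, B(ε,a,0))` is a zero of `(f,g)`. -/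
structure IsBranch (B : ℝ → ℝ → X₁ → X₁) (e : ℝ → ℝ) (r s : ℝ) : Prop where
  lipschitz : ∃ L : ℝ, ∀ a a', |a| ≤ r → |a'| ≤ r → |e a - e a'| ≤ L * |a - a'|
  zero : e 0 = 0
  small : ∀ a, |a| ≤ r → |e a| < s
  sol_f : ∀ a, |a| ≤ r → sys.f (e a) a (B (e a) a 0) = 0
  sol_g : ∀ a, |a| ≤ r → sys.g (e a) a (B (e a) a 0) = 0
  unique : ∀ a, |a| ≤ r → a ≠ 0 → ∀ ε, |ε| < s →
    sys.f ε a (B ε a 0) = 0 → sys.g ε a (B ε a 0) = 0 → ε = e a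

end DiffSystem

/-- Uniform boundedness and Lipschitz regularity on `V` of the family of right inverses:
Lipschitz in `b` from `B₁` to `L(B₂,B₁)`, and in `(ε,a)` with values in `L(X₂,B₁)`. -/
structure BanachScale.RightInverseLipschitz (E : BanachScale X₂ X₁ B₂ B₁)
    (V : Set (ℝ × ℝ × X₁)) (K : ℝ → ℝ → X₁ → (X₂ →L[ℝ] X₁)) (C : ℝ) : Prop where
  lip_b : ∀ ε a b b', (ε, a, b) ∈ V → (ε, a, b') ∈ V → ∀ x,
    ‖E.j (K ε a b x - K ε a b' x)‖ ≤ C * ‖E.j (b - b')‖ * ‖E.k x‖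
  lip_eps_a : ∀ ε a ε' a' b, (ε, a, b) ∈ V → (ε', a', b) ∈ V → ∀ x,
    ‖E.j (K ε a b x - K ε' a' b x)‖ ≤ C * (|ε - ε'| + |a - a'|) * ‖x‖
  bound_X : ∀ ε a b, (ε, a, b) ∈ V → ∀ x, ‖K ε a b x‖ ≤ C * ‖x‖
  bound_B : ∀ ε a b, (ε, a, b) ∈ V → ∀ x, ‖E.j (K ε a b x)‖ ≤ C * ‖E.k x‖

/-- The norm `|a| + ‖b‖` of a pair `(a, b) ∈ ℝ × X₁`. -/
def pairNorm (p : ℝ × X₁) : ℝ := |p.1| + ‖p.2‖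

/-- The vector `γ'(0) x`, for a map `γ` from `ℝ^ℓ` to an `ℓ`-dimensional manifold; Mathlib's tangent
spaces of the manifold are the model space `ℝ^ℓ`. -/
noncomputable def derivAtZero {ℓ : ℕ} {G : Type*} [TopologicalSpace G]
    [ChartedSpace (EuclideanSpace ℝ (Fin ℓ)) G] (γ : EuclideanSpace ℝ (Fin ℓ) → G)
    (x : EuclideanSpace ℝ (Fin ℓ)) : EuclideanSpace ℝ (Fin ℓ) :=
  mfderiv (𝓡 ℓ) (𝓡 ℓ) γ 0 x

/-- For `|ε| ≤ ε₁`, the `ℓ`-dimensional Lie group `G` acts by `Φ ε` on the set of equilibria at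
parameter value `ε`. `D ε` is the derivative at the identity of `g ↦ Φ ε g (0,0)`; Mathlib's tangent
space of `G` at the identity, the Lie algebra, is the model space `ℝ^ℓ`. -/
structure GroupSymmetry {E : BanachScale X₂ X₁ B₂ B₁} (sys : DiffSystem E)
    (V : Set (ℝ × ℝ × X₁)) (ℓ : ℕ) (G : Type*) [Group G] [TopologicalSpace G]
    [ChartedSpace (EuclideanSpace ℝ (Fin ℓ)) G]
    (Φ : ℝ → G → ℝ × X₁ → ℝ × X₁) (D : ℝ → (EuclideanSpace ℝ (Fin ℓ) →L[ℝ] ℝ × X₁))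
    (ε₁ : ℝ) : Prop where
  mapsTo : ∀ ε, |ε| ≤ ε₁ → ∀ g, ∀ p ∈ sys.equilibria ε, Φ ε g p ∈ sys.equilibria ε
  one_act : ∀ ε, |ε| ≤ ε₁ → ∀ p ∈ sys.equilibria ε, Φ ε 1 p = p
  mul_act : ∀ ε, |ε| ≤ ε₁ → ∀ g h, ∀ p ∈ sys.equilibria ε, Φ ε (g * h) p = Φ ε g (Φ ε h p)
  one_to_one : ∀ ε, |ε| ≤ ε₁ → ∀ g h, (∀ p ∈ sys.equilibria ε, Φ ε g p = Φ ε h p) → g = h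
  hasDeriv : ∀ ε, |ε| ≤ ε₁ →
    HasMFDerivAt (𝓡 ℓ) 𝓘(ℝ, ℝ × X₁) (fun g => Φ ε g (0, 0)) (1 : G) (D ε)
  /-- differentiability at the identity is uniform in `ε`, along `C¹` parametrizations -/
  unif_deriv : ∀ (Ω : Set (EuclideanSpace ℝ (Fin ℓ))) (γ : EuclideanSpace ℝ (Fin ℓ) → G),
    IsOpen Ω → 0 ∈ Ω → γ 0 = 1 → ContMDiffOn (𝓡 ℓ) (𝓡 ℓ) 1 γ Ω →
    ∀ κ > 0, ∃ δ > 0, ∀ x, ‖x‖ < δ → ∀ ε, |ε| ≤ ε₁ →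
      pairNorm (Φ ε (γ x) (0, 0) - D ε (derivAtZero γ x)) ≤ κ * ‖x‖
  /-- `D ε` maps the Lie algebra onto `{0} × (ker (Id - S(ε,a,b)) ∩ X₁)` -/
  range_eq : ∀ ε a b, |ε| ≤ ε₁ → (ε, a, b) ∈ V →
    LinearMap.range (D ε).toLinearMap = (⊥ : Submodule ℝ ℝ).prod (sys.kernel ε a b)
  /-- `D ε` is injective, with inverse bounded uniformly in `ε` -/
  inverse_bound : ∃ c : ℝ, ∀ ε, |ε| ≤ ε₁ → ∀ v, ‖v‖ ≤ c * pairNorm (D ε v)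
  lipschitz : ∃ U ∈ 𝓝 (1 : G), ∃ δ > 0, ∃ L : ℝ, ∀ ε, |ε| ≤ ε₁ → ∀ g ∈ U,
    ∀ p ∈ sys.equilibria ε, ∀ q ∈ sys.equilibria ε, pairNorm p < δ → pairNorm q < δ →
      pairNorm (Φ ε g p - Φ ε g q) ≤ L * pairNorm (p - q)
  continuous : ∃ δ > 0, ∀ ε, |ε| ≤ ε₁ → ∀ p ∈ sys.equilibria ε, pairNorm p < δ →
    ∃ U ∈ 𝓝 (1 : G), ContinuousOn (fun g => Φ ε g p) U
  /-- `D` is Lipschitz in `ε` -/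
  deriv_lipschitz : ∃ L : ℝ, ∀ ε ε', |ε| ≤ ε₁ → |ε'| ≤ ε₁ → ‖D ε - D ε'‖ ≤ L * |ε - ε'|

end

/-! This is a Lyapunov–Schmidt reduction followed by a normalization along group orbits. Applying
the right inverse `K`, the equation `g = 0` says exactly that the kernel component `ω = b - K N₂`
lies in `ker (Id - S)` (`g_eq_zero_iff`). Given `ω`, one recovers `b = B(ε,a,ω)` by contraction. The
estimates contract only in the norm of `B₁`, but balls of `X₁` are closed in `B₁`, so Banach's
theorem applies there.

For `ω = 0` the solution satisfies `‖b‖ ≤ |a|` and its Lipschitz constant in `ε` is `O(|a|)`. Hence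
`f/a` equals `R(ε,0,0) - 1` plus a remainder whose Lipschitz constant in `ε` is small
(`reducedRest_sub_le`). Since `R(ε,0,0)` crosses `1` with slope `γ ≠ 0`, a scalar contraction solves
for `ε = e(a)`, uniquely (`exists_isBranch`).

For uniqueness, a small equilibrium `p` is moved by the group until its kernel component vanishes
(`exists_kernelPart_eq_zero`). The components of `Φ(γ(x), p)`, read through the inverse of `D ε`,
form a map of a small ball of `ℝ^ℓ` that is close to the identity. This map is only known to be
continuous, so its zero comes from Brouwer's theorem rather than from a contraction. The moved
equilibrium then has `b' = B(ε,a',0)`. If `a' = 0` it is trivial; otherwise scalar uniqueness puts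
it on the branch, and acting by `g⁻¹` returns to `p`.

Brouwer's theorem is obtained from the no-retraction theorem by the volume-polynomial argument of
Milnor and Rogers. -/

section Brouwer

/-! ### Brouwer's theorem by the volume-polynomial method -/

variable {E : Type*} [NormedAddCommGroup E] [InnerProductSpace ℝ E] [FiniteDimensional ℝ E]

/-- The degree bound is independent of `A`, so the same interpolation nodes in `t` serve at every
point of the ball. -/
theorem exists_polynomial_eval_eq_det (A : E →L[ℝ] E) :
    ∃ p : Polynomial ℝ, p.natDegree ≤ Module.finrank ℝ E ∧
      ∀ t : ℝ, p.eval t = (ContinuousLinearMap.id ℝ E + t • A).det := by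
  let b := Module.finBasis ℝ E
  let M := LinearMap.toMatrix b b (A : E →ₗ[ℝ] E)
  refine ⟨Matrix.det ((Polynomial.X : Polynomial ℝ) • M.map Polynomial.C
    + (1 : Matrix _ _ ℝ).map Polynomial.C), ?_, fun t => ?_⟩
  · simpa using Polynomial.natDegree_det_X_add_C_le M 1
  · rw [← Polynomial.coe_evalRingHom, RingHom.map_det, ContinuousLinearMap.det,
      ← LinearMap.det_toMatrix b]
    congr 1
    ext i j
    simp [M, Matrix.one_apply, LinearMap.toMatrix_apply, Finsupp.single_apply, add_comm, eq_comm]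
    split_ifs <;> simp <;> ring

/-- On the path `Id + s A` from `Id`, where the determinant is `1`, the Neumann series keeps every
operator invertible, so the determinant cannot change sign. -/
theorem det_id_add_pos (A : E →L[ℝ] E) (hA : ‖A‖ < 1) :
    0 < (ContinuousLinearMap.id ℝ E + A).det := by
  by_contra! h
  have hc : ContinuousOn (fun s : ℝ => (ContinuousLinearMap.id ℝ E + s • A).det) (Icc 0 1) := by
    have : Continuous fun s : ℝ => ContinuousLinearMap.id ℝ E + s • A := by fun_prop
    exact (ContinuousLinearMap.continuous_det.comp this).continuousOn
  have := intermediate_value_Icc' zero_le_one hc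
  obtain ⟨s, hs, h0⟩ := this ⟨by simpa using h, by simp [ContinuousLinearMap.det]⟩
  have hn : ‖-(s • A)‖ < 1 := by
    rw [norm_neg, norm_smul, Real.norm_of_nonneg hs.1]
    nlinarith [hs.2, hs.1, norm_nonneg A]
  have hu : IsUnit (1 - -(s • A)) := isUnit_one_sub_of_norm_lt_one hn
  rw [sub_neg_eq_add] at hu
  have := hu.map (ContinuousLinearMap.toLinearMapRingHom : (E →L[ℝ] E) →+* (E →ₗ[ℝ] E))
  have := LinearMap.isUnit_det _ this
  exact this.ne_zero h0

open MeasureTheory in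
-- With `g` extended by zero, `x + t g x` is a small Lipschitz perturbation of the identity, hence a
-- bijection of `E`. It is the identity off the ball, so it maps the ball onto itself, and the
-- change of variables formula computes the volume.
theorem setIntegral_det_eq_of_lipschitz [MeasurableSpace E] [BorelSpace E]
    (g : E → E) (hg : ContDiff ℝ 1 g) (K : NNReal)
    (hK : LipschitzWith K ((Metric.ball (0 : E) 1).indicator g)) (t : ℝ) (ht0 : 0 ≤ t)
    (ht : t * K < 1) :
    ∫ x in Metric.ball (0 : E) 1, (ContinuousLinearMap.id ℝ E + t • fderiv ℝ g x).det =
      (volume : Measure E).real (Metric.ball (0 : E) 1) := by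
  set g' := (Metric.ball (0 : E) 1).indicator g
  obtain ⟨c, hc⟩ : ∃ c : NNReal, (c : ℝ) = t * K := ⟨⟨t * K, by positivity⟩, rfl⟩
  have hc1 : c < 1 := by
    rw [← NNReal.coe_lt_coe, hc]; exact ht
  have happ : ApproximatesLinearOn (fun x => x + t • g' x)
      ((ContinuousLinearEquiv.refl ℝ E : E ≃L[ℝ] E) : E →L[ℝ] E) univ c := by
    intro x _ y _
    have h1 := hK.dist_le_mul x y
    rw [dist_eq_norm, dist_eq_norm] at h1
    have : x + t • g' x - (y + t • g' y) - (x - y) = t • (g' x - g' y) := by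
      rw [smul_sub]; abel
    simp only [ContinuousLinearEquiv.coe_coe, ContinuousLinearEquiv.coe_refl', id]
    rw [this, norm_smul, Real.norm_of_nonneg ht0]
    calc t * ‖g' x - g' y‖ ≤ t * (K * ‖x - y‖) := by gcongr
      _ = c * ‖x - y‖ := by rw [hc, mul_assoc]
  have hcc : Subsingleton E ∨
      c < ‖((ContinuousLinearEquiv.refl ℝ E : E ≃L[ℝ] E).symm : E →L[ℝ] E)‖₊⁻¹ := by
    rcases subsingleton_or_nontrivial E with h | h
    · exact Or.inl h
    · right
      have : ‖((ContinuousLinearEquiv.refl ℝ E : E ≃L[ℝ] E).symm : E →L[ℝ] E)‖₊ = 1 := by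
        ext
        exact ContinuousLinearMap.norm_id
      rw [this, inv_one]
      exact hc1
  have hinj : Function.Injective (fun x => x + t • g' x) :=
    injOn_univ.1 (happ.injOn hcc)
  have hsurj := happ.surjective hcc
  have hout : ∀ x, x ∉ Metric.ball (0 : E) 1 → x + t • g' x = x := by
    intro x hx
    simp [g', hx]
  have himg : (fun x => x + t • g x) '' Metric.ball (0 : E) 1 = Metric.ball (0 : E) 1 := by
    have : (fun x => x + t • g x) '' Metric.ball (0 : E) 1
        = (fun x => x + t • g' x) '' Metric.ball (0 : E) 1 := by
      apply image_congr
      intro x hx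
      simp [g', indicator_of_mem hx]
    rw [this]
    ext y
    constructor
    · rintro ⟨x, hx, rfl⟩
      by_contra hy
      have h2 := hinj (hout _ hy)
      exact hy (h2.symm ▸ hx)
    · intro hy
      obtain ⟨x, rfl⟩ := hsurj y
      refine ⟨x, ?_, rfl⟩
      by_contra hx
      have h3 : x + t • g' x ∈ Metric.ball (0 : E) 1 := hy
      rw [hout x hx] at h3
      exact hx h3
  have hinj' : InjOn (fun x => x + t • g x) (Metric.ball (0 : E) 1) := by
    intro x hx y hy hxy
    apply hinj
    simpa [g', indicator_of_mem hx, indicator_of_mem hy] using hxy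
  have hder : ∀ x ∈ Metric.ball (0 : E) 1, HasFDerivWithinAt (fun x => x + t • g x)
      (ContinuousLinearMap.id ℝ E + t • fderiv ℝ g x) (Metric.ball (0 : E) 1) x := by
    intro x _
    have h := (hg.differentiable one_ne_zero x).hasFDerivAt
    exact ((hasFDerivAt_id x).add (h.const_smul t)).hasFDerivWithinAt
  have hpos : ∀ x ∈ Metric.ball (0 : E) 1,
      0 < (ContinuousLinearMap.id ℝ E + t • fderiv ℝ g x).det := by
    intro x hx
    apply det_id_add_pos
    have h1 : fderiv ℝ g x = fderiv ℝ g' x := by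
      apply Filter.EventuallyEq.fderiv_eq
      filter_upwards [Metric.isOpen_ball.mem_nhds hx] with y hy
      simp [g', indicator_of_mem hy]
    rw [norm_smul, Real.norm_of_nonneg ht0, h1]
    exact (mul_le_mul_of_nonneg_left (norm_fderiv_le_of_lipschitz ℝ hK) ht0).trans_lt ht
  have hvol := integral_image_eq_integral_abs_det_fderiv_smul volume
    (measurableSet_ball (x := (0 : E)) (ε := 1)) hder hinj' (fun _ => (1 : ℝ))
  rw [himg] at hvol
  simp only [smul_eq_mul, mul_one, integral_const, MeasurableSet.univ, measureReal_restrict_apply,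
    univ_inter] at hvol
  rw [hvol]
  apply setIntegral_congr_fun measurableSet_ball
  intro x hx
  exact (abs_of_pos (hpos x hx)).symm

/-- A segment leaving the ball meets the sphere, where `g` vanishes; comparing with that point
reduces everything to the Lipschitz bound on the compact ball. -/
theorem exists_lipschitz_indicator_ball (g : E → E) (hg : ContDiff ℝ 1 g)
    (h0 : ∀ x, ‖x‖ = 1 → g x = 0) :
    ∃ K, LipschitzWith K ((Metric.ball (0 : E) 1).indicator g) := by
  obtain ⟨K, hK⟩ : ∃ K, LipschitzOnWith K g (Metric.closedBall 0 1) := by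
    have hc : ContinuousOn (fun x => ‖fderiv ℝ g x‖₊) (Metric.closedBall 0 1) :=
      (hg.continuous_fderiv one_ne_zero).nnnorm.continuousOn
    obtain ⟨K, hK⟩ := (isCompact_closedBall (0 : E) 1).bddAbove_image hc
    refine ⟨K, (convex_closedBall (0 : E) 1).lipschitzOnWith_of_nnnorm_fderiv_le
      (fun x _ => hg.differentiable one_ne_zero x) fun x hx => hK (mem_image_of_mem _ hx)⟩
  have key : ∀ x y : E, ‖x‖ < 1 → 1 ≤ ‖y‖ → ‖g x‖ ≤ K * ‖x - y‖ := by
    intro x y hx hy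
    have hc : ContinuousOn (fun s : ℝ => ‖x + s • (y - x)‖) (Icc 0 1) := by fun_prop
    obtain ⟨s, hs, h1⟩ := intermediate_value_Icc zero_le_one hc
      (show (1 : ℝ) ∈ _ from ⟨by simpa using hx.le, by simpa using hy⟩)
    simp only at h1
    have h2 := hK.dist_le_mul x (by simpa using hx.le) (x + s • (y - x)) (by simp [h1])
    rw [h0 _ h1, dist_zero_right, dist_eq_norm] at h2
    refine h2.trans ?_
    have : x - (x + s • (y - x)) = s • (x - y) := by rw [smul_sub, smul_sub]; abel
    rw [this, norm_smul, Real.norm_of_nonneg hs.1]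
    gcongr
    exact mul_le_of_le_one_left (norm_nonneg _) hs.2
  refine ⟨K, LipschitzWith.of_dist_le_mul fun x y => ?_⟩
  rw [dist_eq_norm, dist_eq_norm]
  by_cases hx : ‖x‖ < 1 <;> by_cases hy : ‖y‖ < 1
  · simpa [indicator, hx, hy, dist_eq_norm] using
      hK.dist_le_mul x (by simpa using hx.le) y (by simpa using hy.le)
  · simpa [indicator, hx, hy] using key x y hx (not_lt.1 hy)
  · rw [norm_sub_rev x y]
    simpa [indicator, hx, hy] using key y x hy (not_lt.1 hx)
  · simp [indicator, hx, hy]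
    positivity

open MeasureTheory in
/-- There is no `C¹` retraction of the closed unit ball onto the unit sphere. -/
theorem not_exists_contDiff_retraction (r : E → E) (hr : ContDiff ℝ 1 r)
    (h1 : ∀ x, ‖x‖ = 1 → r x = x) (h2 : ∀ x, ‖r x‖ = 1) : False := by
  borelize E
  have hg : ContDiff ℝ 1 (fun x => r x - x) := hr.sub contDiff_id
  obtain ⟨K, hK⟩ := exists_lipschitz_indicator_ball _ hg (fun x hx => by simp [h1 x hx])
  set g := fun x => r x - x with hgdef
  let n := Module.finrank ℝ E
  -- These `n + 1` distinct times all satisfy `v i * K < 1`, so the volume is known at each of them.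
  -- Since the determinant has degree at most `n` in `t`, interpolation carries this to `t = 1`.
  let v : ℕ → ℝ := fun i => ((n + 1 : ℝ) * (K + 1))⁻¹ * i
  have hvpos : 0 < ((n + 1 : ℝ) * (K + 1))⁻¹ := by positivity
  have hv : InjOn v (Finset.range (n + 1)) := by
    intro i _ j _ hij
    exact_mod_cast mul_left_cancel₀ hvpos.ne' hij
  have hne : (Finset.range (n + 1)).Nonempty := by simp
  have hint : ∀ t : ℝ, IntegrableOn
      (fun x => (ContinuousLinearMap.id ℝ E + t • fderiv ℝ g x).det) (Metric.ball (0 : E) 1) := by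
    intro t
    have : Continuous fun x => (ContinuousLinearMap.id ℝ E + t • fderiv ℝ g x).det := by
      have h3 := hg.continuous_fderiv one_ne_zero
      exact ContinuousLinearMap.continuous_det.comp (by fun_prop)
    exact (this.continuousOn.integrableOn_compact (isCompact_closedBall (0 : E) 1)).mono_set
      Metric.ball_subset_closedBall
  have hsum : ∀ x, (ContinuousLinearMap.id ℝ E + (1 : ℝ) • fderiv ℝ g x).det =
      ∑ i ∈ Finset.range (n + 1), (ContinuousLinearMap.id ℝ E + v i • fderiv ℝ g x).det *
        (Lagrange.basis (Finset.range (n + 1)) v i).eval 1 := by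
    intro x
    obtain ⟨p, hp, hpe⟩ := exists_polynomial_eval_eq_det (fderiv ℝ g x)
    have hdeg : p.degree < (Finset.range (n + 1)).card := by
      rw [Finset.card_range]
      exact (Polynomial.degree_le_of_natDegree_le hp).trans_lt (by exact_mod_cast Nat.lt_succ_self n)
    have := congrArg (Polynomial.eval 1) (Lagrange.eq_interpolate hv hdeg)
    rw [← hpe, this, Lagrange.interpolate_apply, Polynomial.eval_finsetSum]
    simp [hpe]
  have hI1 : ∫ x in Metric.ball (0 : E) 1, (ContinuousLinearMap.id ℝ E
      + (1 : ℝ) • fderiv ℝ g x).det = (volume : Measure E).real (Metric.ball (0 : E) 1) := by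
    simp_rw [hsum]
    rw [integral_finsetSum _ fun i _ => (hint (v i)).mul_const _]
    simp_rw [integral_mul_const]
    have : ∀ i ∈ Finset.range (n + 1), (∫ x in Metric.ball (0 : E) 1,
        (ContinuousLinearMap.id ℝ E + v i • fderiv ℝ g x).det) *
          (Lagrange.basis (Finset.range (n + 1)) v i).eval 1
        = (volume : Measure E).real (Metric.ball (0 : E) 1) *
          (Lagrange.basis (Finset.range (n + 1)) v i).eval 1 := by
      intro i hi
      rw [setIntegral_det_eq_of_lipschitz g hg K hK (v i) (by positivity)]
      have hi' : (i : ℝ) < n + 1 := by exact_mod_cast Finset.mem_range.1 hi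
      have hK0 : (0 : ℝ) ≤ K := K.2
      simp only [v]
      rw [inv_mul_eq_div, div_mul_eq_mul_div, div_lt_one (by positivity)]
      nlinarith [(Nat.cast_nonneg i : (0 : ℝ) ≤ i)]
    rw [Finset.sum_congr rfl this, ← Finset.mul_sum, ← Polynomial.eval_finsetSum,
      Lagrange.sum_basis hv hne]
    simp
  have hdet : ∀ x, (ContinuousLinearMap.id ℝ E + (1 : ℝ) • fderiv ℝ g x).det = 0 := by
    intro x
    have hd := (hr.differentiable one_ne_zero x).hasFDerivAt
    have h3 : fderiv ℝ g x = fderiv ℝ r x - ContinuousLinearMap.id ℝ E :=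
      (hd.sub (hasFDerivAt_id x)).fderiv
    rw [h3, one_smul, add_sub_cancel]
    -- Differentiating `‖r‖² = 1` shows that the range of the derivative is orthogonal to `r x ≠ 0`,
    -- so the derivative is singular.
    have horth : ∀ y, inner ℝ (r x) (fderiv ℝ r x y) = 0 := by
      intro y
      have h4 := (hd.norm_sq).unique (show HasFDerivAt _ 0 x by
        simp_rw [h2]; exact hasFDerivAt_const _ _)
      have := congrArg (fun L : E →L[ℝ] ℝ => L y) h4
      simpa using this
    by_contra hne
    have hsurj : Function.Surjective (fderiv ℝ r x : E →ₗ[ℝ] E) :=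
      (LinearMap.equivOfDetNeZero _ hne).surjective
    obtain ⟨y, hy⟩ := hsurj (r x)
    have h5 := horth y
    rw [show fderiv ℝ r x y = r x from hy, real_inner_self_eq_norm_sq, h2] at h5
    norm_num at h5
  simp_rw [hdet] at hI1
  rw [integral_zero] at hI1
  have : 0 < (volume : Measure E).real (Metric.ball (0 : E) 1) :=
    ENNReal.toReal_pos (Metric.measure_ball_pos _ _ one_pos).ne' measure_ball_lt_top.ne
  exact this.ne hI1

/-- A smooth map which on the closed unit ball is less than `3/4` away from the identity has
a zero in that ball. -/
theorem exists_zero_of_contDiff (f : E → E) (hf : ContDiff ℝ 1 f)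
    (hid : ∀ x, ‖x‖ ≤ 1 → ‖f x - x‖ < 3 / 4) : ∃ x, ‖x‖ ≤ 1 ∧ f x = 0 := by
  by_contra! hne
  -- `h` is `f` for `‖x‖ ≤ 3/4` and the identity for `‖x‖ ≥ 1`. In between the correction has norm
  -- below `3/4 < ‖x‖`, so `h` never vanishes and normalizing it gives a forbidden retraction.
  let χ : ContDiffBump (0 : E) := ⟨3 / 4, 1, by norm_num, by norm_num⟩
  let h : E → E := fun x => x + χ x • (f x - x)
  have hh : ContDiff ℝ 1 h := contDiff_id.add (χ.contDiff.smul (hf.sub contDiff_id))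
  have hout : ∀ x, 1 ≤ ‖x‖ → h x = x := by
    intro x hx
    simp [h, χ.zero_of_le_dist (x := x) (by simpa [χ] using hx)]
  have h0 : ∀ x, h x ≠ 0 := by
    intro x hx
    rcases le_or_gt 1 ‖x‖ with h1 | h1
    · rw [hout x h1] at hx
      rw [hx, norm_zero] at h1
      linarith
    rcases le_or_gt ‖x‖ (3 / 4) with h2 | h2
    · have : χ x = 1 := χ.one_of_mem_closedBall (by simpa [χ] using h2)
      exact hne x h1.le (by simpa [h, this] using hx)
    · have h3 : x = -(χ x • (f x - x)) := eq_neg_of_add_eq_zero_left hx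
      have h4 : ‖x‖ = χ x * ‖f x - x‖ := by
        conv_lhs => rw [h3]
        rw [norm_neg, norm_smul, Real.norm_of_nonneg χ.nonneg]
      nlinarith [hid x h1.le, χ.le_one (x := x), χ.nonneg (x := x), norm_nonneg (f x - x)]
  refine not_exists_contDiff_retraction (fun x => ‖h x‖⁻¹ • h x) ?_ ?_ ?_
  · exact ((hh.norm ℝ h0).inv fun x => norm_ne_zero_iff.2 (h0 x)).smul hh
  · intro x hx
    simp [hout x hx.ge, hx]
  · intro x
    rw [norm_smul, norm_inv, norm_norm, inv_mul_cancel₀ (norm_ne_zero_iff.2 (h0 x))]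

/-- A partition of unity glues local constants. The constraint is imposed only on `s`; since `s` is
closed, any constant works near a point outside it. -/
theorem exists_contDiff_approx_of_continuousOn (F : E → E) (s : Set E) (hs : IsClosed s)
    (hF : ContinuousOn F s) (κ : ℝ) (hκ : 0 < κ) :
    ∃ f : E → E, ContDiff ℝ 1 f ∧ ∀ x ∈ s, ‖f x - F x‖ < κ := by
  obtain ⟨f, hf⟩ := exists_contMDiffMap_forall_mem_convex_of_local_const (n := 1) 𝓘(ℝ, E)
    (t := fun x => {y | x ∈ s → y ∈ Metric.ball (F x) κ}) (fun x => by
      by_cases hx : x ∈ s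
      · simpa [hx] using! convex_ball (F x) κ
      · simpa [hx] using! convex_univ) (fun x => by
      by_cases hx : x ∈ s
      · refine ⟨F x, ?_⟩
        have := (hF x hx).eventually (Metric.ball_mem_nhds (F x) hκ)
        rw [eventually_nhdsWithin_iff] at this
        filter_upwards [this] with y hy hys
        rw [Metric.mem_ball']
        exact hy hys
      · refine ⟨0, ?_⟩
        filter_upwards [hs.isOpen_compl.mem_nhds hx] with y hy hys
        exact absurd hys hy)
  refine ⟨f, f.contMDiff.contDiff, fun x hx => ?_⟩
  simpa [dist_eq_norm] using hf x hx

/-- A form of Brouwer's theorem: a continuous map on a closed ball which is close to the identity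
has a zero. -/
theorem exists_zero_of_near_id (F : E → E) (ρ : ℝ) (hρ : 0 < ρ)
    (hF : ContinuousOn F (Metric.closedBall 0 ρ))
    (hid : ∀ x, ‖x‖ ≤ ρ → ‖F x - x‖ ≤ ρ / 2) : ∃ x, ‖x‖ ≤ ρ ∧ F x = 0 := by
  have hmaps : ∀ x : E, ‖x‖ ≤ 1 → ‖ρ • x‖ ≤ ρ := fun x hx => by
    rw [norm_smul, Real.norm_of_nonneg hρ.le]; nlinarith
  let F' : E → E := fun x => ρ⁻¹ • F (ρ • x)
  have hF' : ContinuousOn F' (Metric.closedBall 0 1) := by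
    refine ContinuousOn.const_smul (hF.comp (by fun_prop) fun x hx => ?_) _
    simpa using hmaps x (by simpa using hx)
  have hid' : ∀ x, ‖x‖ ≤ 1 → ‖F' x - x‖ ≤ 1 / 2 := by
    intro x hx
    have h1 : F' x - x = ρ⁻¹ • (F (ρ • x) - ρ • x) := by
      rw [smul_sub, smul_smul, inv_mul_cancel₀ hρ.ne', one_smul]
    rw [h1, norm_smul, norm_inv, Real.norm_of_nonneg hρ.le, inv_mul_le_iff₀ hρ]
    linarith [hid _ (hmaps x hx)]
  suffices ∃ x ∈ Metric.closedBall (0 : E) 1, F' x = 0 by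
    obtain ⟨x, hx, h0⟩ := this
    refine ⟨ρ • x, hmaps x (by simpa using hx), ?_⟩
    simpa [F', hρ.ne'] using h0
  obtain ⟨x, hx, hmin⟩ := (isCompact_closedBall (0 : E) 1).exists_isMinOn ⟨0, by simp⟩ hF'.norm
  refine ⟨x, hx, ?_⟩
  by_contra hne
  -- An error below `1/4` gives `1/2 + 1/4 = 3/4`, so the smooth approximation has a zero; an error
  -- below the minimum of `‖F'‖` makes that zero impossible.
  have hκ : 0 < min ‖F' x‖ (1 / 4) := lt_min (norm_pos_iff.2 hne) (by norm_num)
  obtain ⟨f, hf, hfF⟩ :=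
    exists_contDiff_approx_of_continuousOn F' _ Metric.isClosed_closedBall hF' _ hκ
  obtain ⟨y, hy, hy0⟩ := exists_zero_of_contDiff f hf fun z hz => by
    have h1 := (hfF z (by simpa using hz)).trans_le (min_le_right _ _)
    have h2 := hid' z hz
    calc ‖f z - z‖ = ‖(f z - F' z) + (F' z - z)‖ := by abel_nf
      _ ≤ _ := norm_add_le _ _
      _ < 3 / 4 := by linarith
  have hy' : y ∈ Metric.closedBall (0 : E) 1 := by simpa using hy
  have h3 := (hfF y hy').trans_le (min_le_left _ _)
  rw [hy0, zero_sub, norm_neg] at h3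
  exact absurd (hmin hy') (not_le.2 h3)

end Brouwer

/-! ### Solving the second equation modulo the kernel -/

section Reduction

/-- The map preserves a ball in the strong norm but contracts only in the weak one. The ball, closed
in the complete space `Y`, is itself complete for the weak norm, so Banach's theorem applies to its
image. -/
theorem exists_fixedPoint_of_contraction_through {X Y : Type*} [NormedAddCommGroup X]
    [NormedSpace ℝ X] [NormedAddCommGroup Y] [NormedSpace ℝ Y] [CompleteSpace Y]
    (j : X →L[ℝ] Y) (hj : Function.Injective j) (ρ : ℝ) (hρ : 0 ≤ ρ)
    (hclosed : IsClosed (j '' Metric.closedBall (0 : X) ρ))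
    (T : X → X) (hT : ∀ x, ‖x‖ ≤ ρ → ‖T x‖ ≤ ρ)
    (hcontr : ∀ x y, ‖x‖ ≤ ρ → ‖y‖ ≤ ρ → ‖j (T x - T y)‖ ≤ 1 / 2 * ‖j (x - y)‖) :
    ∃ x, ‖x‖ ≤ ρ ∧ T x = x := by
  let t : Y → Y := fun y => j (T (Function.invFun j y))
  have ht : ∀ x, t (j x) = j (T x) := fun x => by
    simp only [t, Function.leftInverse_invFun hj x]
  have hmaps : MapsTo t (j '' Metric.closedBall (0 : X) ρ) (j '' Metric.closedBall (0 : X) ρ) := by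
    rintro _ ⟨x, hx, rfl⟩
    rw [ht]
    exact mem_image_of_mem _ (by simpa using hT x (by simpa using hx))
  have hc : ContractingWith (1 / 2) (hmaps.restrict t _ _) := by
    refine ⟨by norm_num, LipschitzWith.of_dist_le_mul ?_⟩
    rintro ⟨_, x, hx, rfl⟩ ⟨_, y, hy, rfl⟩
    have := hcontr x y (by simpa using hx) (by simpa using hy)
    rw [map_sub, map_sub] at this
    simpa [Subtype.dist_eq, dist_eq_norm, ht] using this
  obtain ⟨_, ⟨x, hx, rfl⟩, hfix, -⟩ := hc.exists_fixedPoint' hclosed.isComplete hmaps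
    (x := j 0) (mem_image_of_mem _ (by simpa using hρ)) (edist_ne_top _ _)
  refine ⟨x, by simpa using hx, hj ?_⟩
  rw [← ht]
  exact hfix

variable {X₂ X₁ B₂ B₁ : Type*}
  [NormedAddCommGroup X₂] [NormedSpace ℝ X₂] [NormedAddCommGroup X₁] [NormedSpace ℝ X₁]
  [NormedAddCommGroup B₂] [NormedSpace ℝ B₂] [NormedAddCommGroup B₁] [NormedSpace ℝ B₁]

open scoped Pointwise in
theorem BanachScale.isClosed_image_closedBall (E : BanachScale X₂ X₁ B₂ B₁) {ρ : ℝ} (hρ : 0 < ρ) :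
    IsClosed (E.j '' Metric.closedBall (0 : X₁) ρ) := by
  have h : E.j '' Metric.closedBall (0 : X₁) ρ = ρ • (E.j '' Metric.closedBall (0 : X₁) 1) := by
    have hb : Metric.closedBall (0 : X₁) ρ = ρ • Metric.closedBall (0 : X₁) 1 := by
      rw [smul_unitClosedBall, Real.norm_of_nonneg hρ.le]
    rw [hb, ← image_smul, ← image_smul, image_image, image_image]
    simp only [map_smul]
  rw [h]
  exact E.isClosed_ball.smul_of_ne_zero hρ.ne'

/-- The open box of radius `ρ` around the origin. -/
def paramBox (X : Type*) [NormedAddCommGroup X] (ρ : ℝ) : Set (ℝ × ℝ × X) :=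
  {q | |q.1| < ρ ∧ |q.2.1| < ρ ∧ ‖q.2.2‖ < ρ}

theorem exists_paramBox_subset {X : Type*} [NormedAddCommGroup X] {V : Set (ℝ × ℝ × X)}
    (hV : V ∈ 𝓝 (0 : ℝ × ℝ × X)) : ∃ ρ > 0, paramBox X ρ ⊆ V := by
  obtain ⟨ρ, hρ, h⟩ := Metric.mem_nhds_iff.1 hV
  refine ⟨ρ, hρ, fun q hq => h ?_⟩
  obtain ⟨h1, h2, h3⟩ := hq
  simp [Prod.norm_def, h1, h2, h3]

theorem paramBox_mono {X : Type*} [NormedAddCommGroup X] {ρ ρ' : ℝ} (h : ρ ≤ ρ') :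
    paramBox X ρ ⊆ paramBox X ρ' :=
  fun _ hq => ⟨hq.1.trans_le h, hq.2.1.trans_le h, hq.2.2.trans_le h⟩

namespace DiffSystem

variable {E : BanachScale X₂ X₁ B₂ B₁} {sys : DiffSystem E}

/-- The quantitative hypotheses on the box of radius `ρ ≤ 1/4`, with a constant `C ≥ 1`. -/
structure LocalBounds (sys : DiffSystem E) (K : ℝ → ℝ → X₁ → (X₂ →L[ℝ] X₁)) (C ρ : ℝ) :
    Prop where
  one_le : 1 ≤ C
  pos : 0 < ρ
  le : ρ ≤ 1 / 4
  boundsN₁ : sys.BoundsN₁ (paramBox X₁ ρ) C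
  boundsN₂ : sys.BoundsN₂ (paramBox X₁ ρ) C
  boundsR : sys.BoundsR (paramBox X₁ ρ) C
  right_inv : ∀ ε a b, (ε, a, b) ∈ paramBox X₁ ρ →
    ∀ x, K ε a b x - sys.S ε a b (K ε a b x) = E.i x
  lipschitzK : E.RightInverseLipschitz (paramBox X₁ ρ) K C

theorem exists_localBounds {V : Set (ℝ × ℝ × X₁)} (hV : V ∈ 𝓝 (0 : ℝ × ℝ × X₁)) {C : ℝ}
    (hN₁ : sys.BoundsN₁ V C) (hN₂ : sys.BoundsN₂ V C) (hR : sys.BoundsR V C)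
    {K : ℝ → ℝ → X₁ → (X₂ →L[ℝ] X₁)}
    (hK : sys.IsRightInverse V K) (hKlip : E.RightInverseLipschitz V K C) :
    ∃ C' ρ, sys.LocalBounds K C' ρ ∧ paramBox X₁ ρ ⊆ V := by
  obtain ⟨ρ, hρ, hsub⟩ := exists_paramBox_subset hV
  have hs : paramBox X₁ (min ρ (1 / 4)) ⊆ V := (paramBox_mono (min_le_left _ _)).trans hsub
  have hC : C ≤ max C 1 := le_max_left _ _
  refine ⟨max C 1, min ρ (1 / 4), ⟨le_max_right _ _, lt_min hρ (by norm_num), min_le_right _ _,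
    ⟨?_, ?_, ?_⟩, ⟨?_, ?_, ?_⟩, ⟨?_, ?_, ?_⟩, fun ε a b h => hK.right_inv ε a b (hs h),
    ⟨?_, ?_, ?_, ?_⟩⟩, hs⟩
  · exact fun ε a b h => (hN₁.quadratic ε a b (hs h)).trans (by gcongr)
  · exact fun ε a b a' b' h h' => (hN₁.lip_ab ε a b a' b' (hs h) (hs h')).trans (by gcongr)
  · exact fun ε ε' a b h h' => (hN₁.lip_eps ε ε' a b (hs h) (hs h')).trans (by gcongr)
  · exact fun ε a b h => (hN₂.quadratic ε a b (hs h)).trans (by gcongr)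
  · exact fun ε a b a' b' h h' => (hN₂.lip_ab ε a b a' b' (hs h) (hs h')).trans (by gcongr)
  · exact fun ε ε' a b h h' => (hN₂.lip_eps ε ε' a b (hs h) (hs h')).trans (by gcongr)
  · exact fun ε a b h => (hR.bound ε a b (hs h)).trans (by gcongr)
  · exact fun ε a b a' b' h h' => (hR.lip_ab ε a b a' b' (hs h) (hs h')).trans (by gcongr)
  · exact fun ε ε' a b h h' => (hR.lip_eps ε ε' a b (hs h) (hs h')).trans (by gcongr)
  · exact fun ε a b b' h h' x => (hKlip.lip_b ε a b b' (hs h) (hs h') x).trans (by gcongr)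
  · exact fun ε a ε' a' b h h' x => (hKlip.lip_eps_a ε a ε' a' b (hs h) (hs h') x).trans (by gcongr)
  · exact fun ε a b h x => (hKlip.bound_X ε a b (hs h) x).trans (by gcongr)
  · exact fun ε a b h x => (hKlip.bound_B ε a b (hs h) x).trans (by gcongr)

variable {K : ℝ → ℝ → X₁ → (X₂ →L[ℝ] X₁)} {C ρ : ℝ}

theorem LocalBounds.norm_K_N₂_le (h : sys.LocalBounds K C ρ) {ε a : ℝ} {b : X₁}
    (hq : (ε, a, b) ∈ paramBox X₁ ρ) :
    ‖K ε a b (sys.N₂ ε a b)‖ ≤ C ^ 2 * (|a| + ‖b‖) ^ 2 := by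
  have hC := h.one_le
  calc _ ≤ C * ‖sys.N₂ ε a b‖ := h.lipschitzK.bound_X ε a b hq _
    _ ≤ C * (C * (|a| + ‖b‖) ^ 2) := by gcongr; exact h.boundsN₂.quadratic ε a b hq
    _ = _ := by ring

/-- Vary `N₂`, then `b` in `K`, then `(ε,a)` in `K`. The last variation needs the `X₂` norm, but of
`N₂` itself and not of a difference, and there the quadratic bound is available. -/
theorem LocalBounds.norm_K_N₂_sub_le (h : sys.LocalBounds K C ρ) {ε a ε' a' : ℝ} {b b' : X₁}
    (hq : (ε, a, b) ∈ paramBox X₁ ρ) (hq' : (ε', a', b') ∈ paramBox X₁ ρ) :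
    ‖E.j (K ε a b (sys.N₂ ε a b) - K ε' a' b' (sys.N₂ ε' a' b'))‖ ≤
      2 * C ^ 2 * (|a| + |a'| + ‖b‖ + ‖b'‖) * (|ε - ε'| + |a - a'| + ‖E.j (b - b')‖) := by
  have hC := h.one_le
  have hC0 : 0 ≤ C := by linarith
  have hρ := h.le
  have q1 : (ε, a', b') ∈ paramBox X₁ ρ := ⟨hq.1, hq'.2⟩
  have q2 : (ε, a, b') ∈ paramBox X₁ ρ := ⟨hq.1, hq.2.1, hq'.2.2⟩
  set n := sys.N₂ ε a b
  set n' := sys.N₂ ε' a' b'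
  have e1 := h.boundsN₂.lip_ab ε a b a' b' hq q1
  have e2 := h.boundsN₂.lip_eps ε ε' a' b' q1 hq'
  have e3 : ‖E.k (n - n')‖ ≤ C * (|a| + |a'| + ‖b‖ + ‖b'‖) * (|a - a'| + ‖E.j (b - b')‖)
      + C * (|a'| + ‖b'‖) ^ 2 * |ε - ε'| := by
    have : E.k (n - n') = E.k (n - sys.N₂ ε a' b') + E.k (sys.N₂ ε a' b' - n') := by
      rw [← map_add]; congr 1; abel
    rw [this]
    exact (norm_add_le _ _).trans (add_le_add e1 e2)
  have e4 := h.lipschitzK.bound_B ε a b hq (n - n')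
  have e5 := h.lipschitzK.lip_b ε a b b' hq q2 n'
  have e6 := h.lipschitzK.lip_eps_a ε a ε' a' b' q2 hq' n'
  have e7 : ‖n'‖ ≤ C * (|a'| + ‖b'‖) ^ 2 := h.boundsN₂.quadratic ε' a' b' hq'
  have e8 := E.norm_k_le n'
  have hsplit : E.j (K ε a b n - K ε' a' b' n') = E.j (K ε a b (n - n')) +
      (E.j (K ε a b n' - K ε a b' n') + E.j (K ε a b' n' - K ε' a' b' n')) := by
    simp only [map_sub]; abel
  have hb := norm_nonneg b
  have hb' := norm_nonneg b'
  have ha := abs_nonneg a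
  have ha' := abs_nonneg a'
  -- The radius is at most `1/4`, so `|a'| + ‖b'‖ < 1` and a square may be traded for a first power.
  have hm' : (|a'| + ‖b'‖) ^ 2 ≤ |a| + |a'| + ‖b‖ + ‖b'‖ := by
    have h1 : |a'| < ρ := hq'.2.1
    have h2 : ‖b'‖ < ρ := hq'.2.2
    nlinarith
  set m := |a| + |a'| + ‖b‖ + ‖b'‖
  set x := |ε - ε'|
  set y := |a - a'|
  set z := ‖E.j (b - b')‖
  have hx : 0 ≤ x := abs_nonneg _
  have hy : 0 ≤ y := abs_nonneg _
  have hz : 0 ≤ z := norm_nonneg _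
  have e9 : ‖n'‖ ≤ C * m := e7.trans (by gcongr)
  rw [hsplit]
  calc _ ≤ _ := (norm_add_le _ _).trans (add_le_add_right (norm_add_le _ _) _)
    _ ≤ C * ‖E.k (n - n')‖ + (C * z * ‖E.k n'‖ + C * (x + y) * ‖n'‖) := by gcongr
    _ ≤ C * (C * m * (y + z) + C * m * x) + (C * z * (C * m) + C * (x + y) * (C * m)) := by
      gcongr
      · exact e3.trans (by gcongr)
      · exact e8.trans e9
    _ = _ := by ring

/-- Two solutions of the fixed point equation, for different parameters. -/
theorem LocalBounds.norm_fixedPoint_sub_le (h : sys.LocalBounds K C ρ) {ε a ε' a' : ℝ}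
    {b b' w w' : X₁}
    (hq : (ε, a, b) ∈ paramBox X₁ ρ) (hq' : (ε', a', b') ∈ paramBox X₁ ρ)
    (hb : sys.T K ε a b w = b) (hb' : sys.T K ε' a' b' w' = b')
    (hm : 4 * C ^ 2 * (|a| + |a'| + ‖b‖ + ‖b'‖) ≤ 1) :
    ‖E.j (b - b')‖ ≤ 2 * ‖E.j (w - w')‖ +
      4 * C ^ 2 * (|a| + |a'| + ‖b‖ + ‖b'‖) * (|ε - ε'| + |a - a'|) := by
  have e := h.norm_K_N₂_sub_le hq hq'
  have hs : E.j (b - b') =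
      E.j (w - w') + E.j (K ε a b (sys.N₂ ε a b) - K ε' a' b' (sys.N₂ ε' a' b')) := by
    conv_lhs => rw [← hb, ← hb', T, T]
    rw [← map_add]; congr 1; abel
  have e2 := norm_add_le (E.j (w - w'))
    (E.j (K ε a b (sys.N₂ ε a b) - K ε' a' b' (sys.N₂ ε' a' b')))
  rw [← hs] at e2
  -- Half of the left-hand side is absorbed, which doubles the remaining terms.
  have e3 : 2 * C ^ 2 * (|a| + |a'| + ‖b‖ + ‖b'‖) * ‖E.j (b - b')‖ ≤ 1 / 2 * ‖E.j (b - b')‖ := by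
    gcongr; linarith
  nlinarith

/-- The contraction runs on the closed ball of radius `η/2`, which is preserved because `‖w‖ < η/4`
and `C² η² ≤ η/16`. Uniqueness in the larger ball of radius `η` follows from comparing two
solutions, where `16 C² η ≤ 1` bounds the sum of four quantities below `η`. -/
theorem LocalBounds.exists_isReduction [CompleteSpace B₁] (h : sys.LocalBounds K C ρ)
    {η : ℝ} (hη : 0 < η) (hηρ : η ≤ ρ) (hCη : 16 * C ^ 2 * η ≤ 1) :
    ∃ B, sys.IsReduction K B (η / 4) η := by
  have hC := h.one_le
  have hbox : ∀ ε a (w b : X₁), |ε| + |a| + ‖w‖ < η / 4 → ‖b‖ < η →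
      (ε, a, b) ∈ paramBox X₁ ρ := by
    intro ε a w b hq hb
    have := abs_nonneg ε
    have := abs_nonneg a
    have := norm_nonneg w
    exact ⟨by linarith, by linarith, by linarith⟩
  have hm : ∀ ε a (w b : X₁) ε' a' (w' b' : X₁), |ε| + |a| + ‖w‖ < η / 4 → ‖b‖ < η →
      |ε'| + |a'| + ‖w'‖ < η / 4 → ‖b'‖ < η → 4 * C ^ 2 * (|a| + |a'| + ‖b‖ + ‖b'‖) ≤ 1 := by
    intro ε a w b ε' a' w' b' hq hb hq' hb'
    have := abs_nonneg ε
    have := abs_nonneg ε'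
    have := norm_nonneg w
    have := norm_nonneg w'
    calc _ ≤ 4 * C ^ 2 * (4 * η) := by gcongr; linarith
      _ = 16 * C ^ 2 * η := by ring
      _ ≤ 1 := hCη
  have huniq : ∀ ε a (w b b' : X₁), |ε| + |a| + ‖w‖ < η / 4 → ‖b‖ < η → ‖b'‖ < η →
      sys.T K ε a b w = b → sys.T K ε a b' w = b' → b = b' := by
    intro ε a w b b' hq hb hb' hT hT'
    have := h.norm_fixedPoint_sub_le (hbox _ _ _ _ hq hb) (hbox _ _ _ _ hq hb') hT hT'
      (hm _ _ _ _ _ _ _ _ hq hb hq hb')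
    simp only [sub_self, map_zero, norm_zero, abs_zero, add_zero, mul_zero] at this
    exact E.j_injective (sub_eq_zero.1 (by rw [← map_sub]; simpa using this))
  have hex : ∀ ε a (w : X₁), ∃ b, |ε| + |a| + ‖w‖ < η / 4 → ‖b‖ < η ∧ sys.T K ε a b w = b := by
    intro ε a w
    by_cases hq : |ε| + |a| + ‖w‖ < η / 4
    swap
    · exact ⟨0, fun hc => absurd hc hq⟩
    obtain ⟨b, hb, hT⟩ := exists_fixedPoint_of_contraction_through E.j E.j_injective (η / 2)
      (by positivity) (E.isClosed_image_closedBall (by positivity)) (fun b => sys.T K ε a b w) (by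
        intro b hb
        have e1 := h.norm_K_N₂_le (hbox ε a w b hq (by linarith))
        have e2 : ‖sys.T K ε a b w‖ ≤ ‖w‖ + ‖K ε a b (sys.N₂ ε a b)‖ := norm_add_le _ _
        have := abs_nonneg ε
        have ha := abs_nonneg a
        have hw := norm_nonneg w
        have e3 : C ^ 2 * (|a| + ‖b‖) ^ 2 ≤ C ^ 2 * η ^ 2 := by
          gcongr; linarith
        nlinarith) (by
        intro b b' hb hb'
        have e1 := h.norm_K_N₂_sub_le (hbox ε a w b hq (by linarith))
          (hbox ε a w b' hq (by linarith))
        simp only [sub_self, abs_zero, zero_add] at e1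
        have e2 := hm ε a w b ε a w b' hq (by linarith) hq (by linarith)
        simp only [T, add_sub_add_left_eq_sub]
        refine e1.trans ?_
        gcongr
        linarith)
    exact ⟨b, fun _ => ⟨by linarith, hT⟩⟩
  choose B hB using hex
  refine ⟨B, fun ε a w hq => ⟨(hB ε a w hq).1, (hB ε a w hq).2, fun b hb hT =>
    huniq ε a w b _ hq hb (hB ε a w hq).1 hT (hB ε a w hq).2⟩, fun ε hε => ?_, 2, ?_⟩
  · have hq : |ε| + |(0 : ℝ)| + ‖(0 : X₁)‖ < η / 4 := by simpa using hε
    refine huniq ε 0 0 _ 0 hq (hB ε 0 0 hq).1 (by simpa using hη) (hB ε 0 0 hq).2 ?_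
    have := h.norm_K_N₂_le (hbox ε 0 0 0 hq (by simpa using hη))
    simpa [T] using this
  · intro ε a w ε' a' w' hq hq'
    obtain ⟨h1, h2⟩ := hB ε a w hq
    obtain ⟨h3, h4⟩ := hB ε' a' w' hq'
    have e1 := hm ε a w _ ε' a' w' _ hq h1 hq' h3
    have e2 := h.norm_fixedPoint_sub_le (hbox _ _ _ _ hq h1) (hbox _ _ _ _ hq' h3) h2 h4 e1
    have e3 : 4 * C ^ 2 * (|a| + |a'| + ‖B ε a w‖ + ‖B ε' a' w'‖) * (|ε - ε'| + |a - a'|)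
      ≤ 1 * (|ε - ε'| + |a - a'|) := by gcongr
    have := abs_nonneg (ε - ε')
    have := abs_nonneg (a - a')
    linarith

/-- The second equation holds exactly when `b - K N₂` lies in the kernel of `Id - S`. -/
theorem LocalBounds.g_eq_zero_iff (h : sys.LocalBounds K C ρ) {ε a : ℝ} {b : X₁}
    (hq : (ε, a, b) ∈ paramBox X₁ ρ) :
    sys.g ε a b = 0 ↔ b - K ε a b (sys.N₂ ε a b) ∈ sys.kernel ε a b := by
  have e := h.right_inv ε a b hq (sys.N₂ ε a b)
  have : sys.g ε a b = -((b - K ε a b (sys.N₂ ε a b)) -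
      sys.S ε a b (b - K ε a b (sys.N₂ ε a b))) := by
    rw [g, ← e, map_sub]; abel
  rw [this, neg_eq_zero]
  simp [kernel, LinearMap.mem_ker]

end DiffSystem

end Reduction

/-! ### The scalar equation and the bifurcating branch -/

section Branch

/-- A contraction in `ε` depending on the parameter `a`: for `|ε| ≤ s/2`, the bound `M r ≤ s/4`
gives `|Θ| ≤ s/4 + s/4`. Comparing two fixed points yields both uniqueness and the Lipschitz
estimate. -/
theorem exists_scalar_branch (Θ : ℝ → ℝ → ℝ) {r s M : ℝ} (hr : 0 ≤ r) (hs : 0 < s) (hM : 0 ≤ M)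
    (hΘ : ∀ ε a ε' a', |ε| < s → |a| ≤ r → |ε'| < s → |a'| ≤ r →
      |Θ ε a - Θ ε' a'| ≤ 1 / 2 * |ε - ε'| + M * |a - a'|)
    (h0 : Θ 0 0 = 0) (hMr : M * r ≤ s / 4) :
    ∃ e : ℝ → ℝ, e 0 = 0 ∧ (∀ a, |a| ≤ r → |e a| < s ∧ Θ (e a) a = e a ∧
      ∀ ε, |ε| < s → Θ ε a = ε → ε = e a) ∧
      ∀ a a', |a| ≤ r → |a'| ≤ r → |e a - e a'| ≤ 2 * M * |a - a'| := by
  have hlip : ∀ ε a ε' a', |ε| < s → |a| ≤ r → |ε'| < s → |a'| ≤ r → Θ ε a = ε → Θ ε' a' = ε' →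
      |ε - ε'| ≤ 2 * M * |a - a'| := by
    intro ε a ε' a' h1 h2 h3 h4 h5 h6
    have := hΘ ε a ε' a' h1 h2 h3 h4
    rw [h5, h6] at this
    linarith
  have hex : ∀ a, ∃ ε, |a| ≤ r → |ε| < s ∧ Θ ε a = ε := by
    intro a
    by_cases ha : |a| ≤ r
    swap
    · exact ⟨0, fun h => absurd h ha⟩
    obtain ⟨ε, hε, hfix⟩ := exists_fixedPoint_of_contraction_through
      (ContinuousLinearMap.id ℝ ℝ) Function.injective_id (s / 2) (by positivity)
      (by simpa using Metric.isClosed_closedBall) (fun ε => Θ ε a) (by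
        intro ε hε
        rw [Real.norm_eq_abs] at *
        have := hΘ ε a 0 0 (by linarith) ha (by simpa using hs) (by simpa using hr)
        rw [h0, sub_zero, sub_zero, sub_zero] at this
        nlinarith) (by
        intro ε ε' hε hε'
        rw [Real.norm_eq_abs] at *
        have := hΘ ε a ε' a (by linarith) ha (by linarith) ha
        simpa using this)
    exact ⟨ε, fun _ => ⟨by rw [Real.norm_eq_abs] at hε; linarith, hfix⟩⟩
  choose e he using hex
  refine ⟨e, ?_, fun a ha => ⟨(he a ha).1, (he a ha).2, fun ε hε hfix => ?_⟩, fun a a' ha ha' => ?_⟩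
  · have hr0 : |(0 : ℝ)| ≤ r := by simpa using hr
    have := hlip (e 0) 0 0 0 (he 0 hr0).1 hr0 (by simpa using hs) hr0 (he 0 hr0).2 h0
    simpa using this
  · have := hlip ε a (e a) a hε ha (he a ha).1 ha hfix (he a ha).2
    simpa [sub_eq_zero] using this
  · exact hlip _ _ _ _ (he a ha).1 ha (he a' ha').1 ha' (he a ha).2 (he a' ha').2

variable {X₂ X₁ B₂ B₁ : Type*}
  [NormedAddCommGroup X₂] [NormedSpace ℝ X₂] [NormedAddCommGroup X₁] [NormedSpace ℝ X₁]
  [NormedAddCommGroup B₂] [NormedSpace ℝ B₂] [NormedAddCommGroup B₁] [NormedSpace ℝ B₁]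

namespace DiffSystem

variable {E : BanachScale X₂ X₁ B₂ B₁} {sys : DiffSystem E}
  {K : ℝ → ℝ → X₁ → (X₂ →L[ℝ] X₁)} {C ρ η : ℝ} {B : ℝ → ℝ → X₁ → X₁}

/-- The part of `f(ε,a,B(ε,a,0))/a` which is small compared with `R(ε,0,0) - 1`. -/
noncomputable def reducedRest (sys : DiffSystem E) (B : ℝ → ℝ → X₁ → X₁) (ε a : ℝ) : ℝ :=
  (sys.R ε a (B ε a 0) - sys.R ε 0 0) + sys.N₁ ε a (B ε a 0) / a

theorem f_reduction_eq (ε : ℝ) {a : ℝ} (ha : a ≠ 0) :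
    sys.f ε a (B ε a 0) = a * (sys.R ε 0 0 - 1 + sys.reducedRest B ε a) := by
  rw [f, reducedRest]
  field_simp
  ring

theorem LocalBounds.reduction_mem_paramBox (h : sys.LocalBounds K C ρ) (hηρ : η ≤ ρ)
    (hB : sys.IsReduction K B (η / 4) η) {ε a : ℝ} {w : X₁} (hq : |ε| + |a| + ‖w‖ < η / 4) :
    (ε, a, B ε a w) ∈ paramBox X₁ ρ := by
  have := h.pos
  have := abs_nonneg ε
  have := abs_nonneg a
  have := norm_nonneg w
  exact ⟨by linarith, by linarith, (hB.1 ε a w hq).1.trans_le hηρ⟩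

/-- For `w = 0` the solution equals `K N₂`, which is quadratic, hence at most half of `|a| + ‖b‖`;
absorb `‖b‖ / 2`. -/
theorem LocalBounds.norm_reduction_le (h : sys.LocalBounds K C ρ) (hη : 0 < η) (hηρ : η ≤ ρ)
    (hCη : 16 * C ^ 2 * η ≤ 1) (hB : sys.IsReduction K B (η / 4) η) {ε a : ℝ}
    (hq : |ε| + |a| < η / 4) : ‖B ε a 0‖ ≤ |a| := by
  have hq' : |ε| + |a| + ‖(0 : X₁)‖ < η / 4 := by simpa using hq
  have hbox := h.reduction_mem_paramBox hηρ hB hq'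
  obtain ⟨h1, h2, -⟩ := hB.1 ε a 0 hq'
  have e1 := h.norm_K_N₂_le hbox
  rw [T, zero_add] at h2
  rw [h2] at e1
  have ha := abs_nonneg a
  have hb := norm_nonneg (B ε a 0)
  have := abs_nonneg ε
  have hC := h.one_le
  have e2 : C ^ 2 * (|a| + ‖B ε a 0‖) ≤ 1 / 2 := by
    calc _ ≤ C ^ 2 * (8 * η) := by gcongr; linarith
      _ = 16 * C ^ 2 * η / 2 := by ring
      _ ≤ _ := by linarith
  have e3 : C ^ 2 * (|a| + ‖B ε a 0‖) ^ 2 ≤ 1 / 2 * (|a| + ‖B ε a 0‖) := by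
    rw [pow_two (|a| + _), ← mul_assoc]
    gcongr
  linarith

/-- The gain over the general Lipschitz bound is the factor `|a| + |a'|`. It survives because the
`w` term is absent, and it makes the dependence of the remainder on `ε` weak. -/
theorem LocalBounds.norm_reduction_sub_le (h : sys.LocalBounds K C ρ) (hη : 0 < η) (hηρ : η ≤ ρ)
    (hCη : 16 * C ^ 2 * η ≤ 1) (hB : sys.IsReduction K B (η / 4) η) {ε a ε' a' : ℝ}
    (hq : |ε| + |a| < η / 4) (hq' : |ε'| + |a'| < η / 4) :
    ‖E.j (B ε a 0 - B ε' a' 0)‖ ≤ 8 * C ^ 2 * (|a| + |a'|) * (|ε - ε'| + |a - a'|) := by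
  have h0 : |ε| + |a| + ‖(0 : X₁)‖ < η / 4 := by simpa using hq
  have h0' : |ε'| + |a'| + ‖(0 : X₁)‖ < η / 4 := by simpa using hq'
  have e1 := h.norm_reduction_le hη hηρ hCη hB hq
  have e2 := h.norm_reduction_le hη hηρ hCη hB hq'
  have hC := h.one_le
  have ha := abs_nonneg ε
  have ha' := abs_nonneg ε'
  have e := h.norm_fixedPoint_sub_le (h.reduction_mem_paramBox hηρ hB h0)
    (h.reduction_mem_paramBox hηρ hB h0') (hB.1 ε a 0 h0).2.1 (hB.1 ε' a' 0 h0').2.1 (by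
      calc _ ≤ 4 * C ^ 2 * (4 * η) := by gcongr; linarith
        _ = 16 * C ^ 2 * η := by ring
        _ ≤ 1 := hCη)
  rw [sub_self, map_zero, norm_zero, mul_zero, zero_add] at e
  refine e.trans ?_
  rw [show 8 * C ^ 2 * (|a| + |a'|) = 4 * C ^ 2 * (2 * (|a| + |a'|)) by ring]
  gcongr
  linarith

theorem LocalBounds.R_sub_reduction_le (h : sys.LocalBounds K C ρ) (hη : 0 < η) (hηρ : η ≤ ρ)
    (hCη : 16 * C ^ 2 * η ≤ 1) (hB : sys.IsReduction K B (η / 4) η) {ε a ε' a' : ℝ}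
    (hq : |ε| + |a| < η / 4) (hq' : |ε'| + |a'| < η / 4) (haa : |a'| ≤ |a|) :
    |(sys.R ε a (B ε a 0) - sys.R ε 0 0) - (sys.R ε' a' (B ε' a' 0) - sys.R ε' 0 0)| ≤
      18 * C ^ 3 * ((|ε| + |ε'| + |a|) * |ε - ε'| + |a - a'|) := by
  have h0 : |ε| + |a| + ‖(0 : X₁)‖ < η / 4 := by simpa using hq
  have h0' : |ε'| + |a'| + ‖(0 : X₁)‖ < η / 4 := by simpa using hq'
  have hb := h.reduction_mem_paramBox hηρ hB h0
  have hb' := h.reduction_mem_paramBox hηρ hB h0'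
  have e1 := h.norm_reduction_le hη hηρ hCη hB hq
  have e2 := h.norm_reduction_sub_le hη hηρ hCη hB hq hq'
  have hC := h.one_le
  have hρ := h.le
  have hq2 : (ε', a, B ε a 0) ∈ paramBox X₁ ρ := ⟨hb'.1, hb.2⟩
  have e3 := h.boundsR.lip_eps ε ε' a _ hb hq2
  have e4 := h.boundsR.lip_ab ε' a (B ε a 0) a' (B ε' a' 0) hq2 hb'
  set b := B ε a 0
  set b' := B ε' a' 0
  have ha : |a| ≤ 1 / 16 := by linarith [abs_nonneg ε]
  have hx := abs_nonneg (ε - ε')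
  have hy := abs_nonneg (a - a')
  have hε := abs_nonneg ε
  have hε' := abs_nonneg ε'
  have ha0 := abs_nonneg a
  have ha0' := abs_nonneg a'
  have e5 : ‖E.j (b - b')‖ ≤ 16 * C ^ 2 * |a| * |ε - ε'| + C ^ 2 * |a - a'| := by
    calc _ ≤ 8 * C ^ 2 * (|a| + |a'|) * (|ε - ε'| + |a - a'|) := e2
      _ ≤ 8 * C ^ 2 * (2 * |a|) * (|ε - ε'| + |a - a'|) := by gcongr; linarith
      _ = 16 * C ^ 2 * |a| * |ε - ε'| + C ^ 2 * |a - a'| * (16 * |a|) := by ring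
      _ ≤ 16 * C ^ 2 * |a| * |ε - ε'| + C ^ 2 * |a - a'| * 1 := by gcongr; linarith
      _ = _ := by ring
  have c1 : C ≤ C ^ 3 := by nlinarith [sq_nonneg C]
  calc _ = |((sys.R ε a b - sys.R ε 0 0) - (sys.R ε' a b - sys.R ε' 0 0)) +
        (sys.R ε' a b - sys.R ε' a' b')| := by ring_nf
    _ ≤ _ := abs_add_le _ _
    _ ≤ C * (|ε| + |ε'| + |a| + ‖b‖) * |ε - ε'| + C * (|a - a'| + ‖E.j (b - b')‖) :=
      add_le_add e3 e4
    _ ≤ C * (2 * (|ε| + |ε'| + |a|)) * |ε - ε'| + C * (|a - a'| +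
        (16 * C ^ 2 * |a| * |ε - ε'| + C ^ 2 * |a - a'|)) := by gcongr; linarith
    _ = (2 * C * (|ε| + |ε'| + |a|) + 16 * C ^ 3 * |a|) * |ε - ε'| + (C + C ^ 3) * |a - a'| := by
      ring
    _ ≤ (2 * C ^ 3 * (|ε| + |ε'| + |a|) + 16 * C ^ 3 * (|ε| + |ε'| + |a|)) * |ε - ε'|
        + (C ^ 3 + 17 * C ^ 3) * |a - a'| := by
      gcongr <;> linarith
    _ = _ := by ring

/-- Differences of `N₁` carry a factor `|a|`, which pays for the division. Changing the denominator
costs only `O(|a - a'|)`, because `N₁` is `O(|a'|²)` at the second point and `|a'| ≤ |a|`. -/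
theorem LocalBounds.N₁_div_sub_reduction_le (h : sys.LocalBounds K C ρ) (hη : 0 < η) (hηρ : η ≤ ρ)
    (hCη : 16 * C ^ 2 * η ≤ 1) (hB : sys.IsReduction K B (η / 4) η) {ε a ε' a' : ℝ}
    (hq : |ε| + |a| < η / 4) (hq' : |ε'| + |a'| < η / 4) (haa : |a'| ≤ |a|) :
    |sys.N₁ ε a (B ε a 0) / a - sys.N₁ ε' a' (B ε' a' 0) / a'| ≤
      68 * C ^ 3 * (|a| * |ε - ε'| + |a - a'|) := by
  have h0 : |ε| + |a| + ‖(0 : X₁)‖ < η / 4 := by simpa using hq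
  have h0' : |ε'| + |a'| + ‖(0 : X₁)‖ < η / 4 := by simpa using hq'
  have hb := h.reduction_mem_paramBox hηρ hB h0
  have hb' := h.reduction_mem_paramBox hηρ hB h0'
  have e1 := h.norm_reduction_le hη hηρ hCη hB hq
  have e1' := h.norm_reduction_le hη hηρ hCη hB hq'
  have e2 := h.norm_reduction_sub_le hη hηρ hCη hB hq hq'
  have hC := h.one_le
  have hρ := h.le
  have hq2 : (ε', a, B ε a 0) ∈ paramBox X₁ ρ := ⟨hb'.1, hb.2⟩
  have e3 := h.boundsN₁.lip_eps ε ε' a _ hb hq2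
  have e4 := h.boundsN₁.lip_ab ε' a (B ε a 0) a' (B ε' a' 0) hq2 hb'
  have e5 := h.boundsN₁.quadratic ε' a' _ hb'
  set b := B ε a 0
  set b' := B ε' a' 0
  have ha : |a| ≤ 1 / 16 := by linarith [abs_nonneg ε]
  have hx := abs_nonneg (ε - ε')
  have hy := abs_nonneg (a - a')
  have ha0 := abs_nonneg a
  have ha0' := abs_nonneg a'
  rcases eq_or_ne a 0 with rfl | hne
  · have : a' = 0 := by simpa using haa
    subst this
    simp
  have hapos : 0 < |a| := abs_pos.2 hne
  have c1 : C ≤ C ^ 3 := by nlinarith [sq_nonneg C]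
  have e6 : ‖E.j (b - b')‖ ≤ 16 * C ^ 2 * |a| * |ε - ε'| + C ^ 2 * |a - a'| := by
    calc _ ≤ 8 * C ^ 2 * (|a| + |a'|) * (|ε - ε'| + |a - a'|) := e2
      _ ≤ 8 * C ^ 2 * (2 * |a|) * (|ε - ε'| + |a - a'|) := by gcongr; linarith
      _ = 16 * C ^ 2 * |a| * |ε - ε'| + C ^ 2 * |a - a'| * (16 * |a|) := by ring
      _ ≤ 16 * C ^ 2 * |a| * |ε - ε'| + C ^ 2 * |a - a'| * 1 := by gcongr; linarith
      _ = _ := by ring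
  have e7 : |sys.N₁ ε a b - sys.N₁ ε' a' b'| ≤
      |a| * (68 * C ^ 3 * |a| * |ε - ε'| + 8 * C ^ 3 * |a - a'|) := by
    calc _ = |(sys.N₁ ε a b - sys.N₁ ε' a b) + (sys.N₁ ε' a b - sys.N₁ ε' a' b')| := by ring_nf
      _ ≤ _ := abs_add_le _ _
      _ ≤ _ := add_le_add e3 e4
      _ ≤ C * (2 * |a|) ^ 2 * |ε - ε'| + C * (4 * |a|) * (|a - a'| +
        (16 * C ^ 2 * |a| * |ε - ε'| + C ^ 2 * |a - a'|)) := by gcongr <;> linarith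
      _ = |a| * ((4 * C + 64 * C ^ 3) * |a| * |ε - ε'| + (4 * C + 4 * C ^ 3) * |a - a'|) := by ring
      _ ≤ |a| * ((4 * C ^ 3 + 64 * C ^ 3) * |a| * |ε - ε'|
          + (4 * C ^ 3 + 4 * C ^ 3) * |a - a'|) := by gcongr
      _ = _ := by ring
  have e8 : |sys.N₁ ε' a' b'| ≤ 4 * C * |a'| ^ 2 := by
    calc _ ≤ _ := e5
      _ ≤ C * (2 * |a'|) ^ 2 := by gcongr; linarith
      _ = _ := by ring
  have e9 : |sys.N₁ ε' a' b' / a - sys.N₁ ε' a' b' / a'| ≤ 4 * C * |a - a'| := by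
    -- For `a' = 0` the quotient is `0` by convention, which is the right value since `N₁` vanishes
    -- there.
    rcases eq_or_ne a' 0 with h | hne'
    · rw [h] at e8 ⊢
      have : sys.N₁ ε' 0 b' = 0 := by simpa using e8
      rw [this]
      simp
      positivity
    · have hapos' : 0 < |a'| := abs_pos.2 hne'
      have : sys.N₁ ε' a' b' / a - sys.N₁ ε' a' b' / a' =
          sys.N₁ ε' a' b' * (a' - a) / (a * a') := by field_simp
      rw [this, abs_div, abs_mul, abs_mul, div_le_iff₀ (by positivity), abs_sub_comm a' a]
      calc _ ≤ 4 * C * |a'| ^ 2 * |a - a'| := by gcongr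
        _ = 4 * C * |a - a'| * (|a'| * |a'|) := by ring
        _ ≤ _ := by gcongr
  have e10 : |sys.N₁ ε a b / a - sys.N₁ ε' a' b' / a| ≤
      68 * C ^ 3 * |a| * |ε - ε'| + 8 * C ^ 3 * |a - a'| := by
    rw [← sub_div, abs_div, div_le_iff₀ hapos, mul_comm _ |a|]
    exact e7
  calc _ = |(sys.N₁ ε a b / a - sys.N₁ ε' a' b' / a) +
        (sys.N₁ ε' a' b' / a - sys.N₁ ε' a' b' / a')| := by ring_nf
    _ ≤ _ := abs_add_le _ _
    _ ≤ _ := add_le_add e10 e9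
    _ ≤ 68 * C ^ 3 * |a| * |ε - ε'| + 8 * C ^ 3 * |a - a'| + 60 * C ^ 3 * |a - a'| := by
      gcongr; linarith
    _ = _ := by ring

theorem LocalBounds.reducedRest_sub_le (h : sys.LocalBounds K C ρ) (hη : 0 < η) (hηρ : η ≤ ρ)
    (hCη : 16 * C ^ 2 * η ≤ 1) (hB : sys.IsReduction K B (η / 4) η) {ε a ε' a' : ℝ}
    (hq : |ε| + |a| < η / 4) (hq' : |ε'| + |a'| < η / 4) :
    |sys.reducedRest B ε a - sys.reducedRest B ε' a'| ≤
      86 * C ^ 3 * ((|ε| + |ε'| + |a| + |a'|) * |ε - ε'| + |a - a'|) := by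
  wlog haa : |a'| ≤ |a| generalizing ε a ε' a'
  · have := this hq' hq (not_le.1 haa).le
    rw [abs_sub_comm, abs_sub_comm ε ε', abs_sub_comm a a']
    refine this.trans (le_of_eq ?_)
    ring
  have hC := h.one_le
  have e1 := h.R_sub_reduction_le hη hηρ hCη hB hq hq' haa
  have e2 := h.N₁_div_sub_reduction_le hη hηρ hCη hB hq hq' haa
  have hε := abs_nonneg ε
  have hε' := abs_nonneg ε'
  have ha0 := abs_nonneg a
  have ha0' := abs_nonneg a'
  unfold reducedRest
  rw [add_sub_add_comm]
  refine (abs_add_le _ _).trans ((add_le_add e1 e2).trans ?_)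
  have m1 : |ε| + |ε'| + |a| ≤ |ε| + |ε'| + |a| + |a'| := by linarith
  have m2 : |a| ≤ |ε| + |ε'| + |a| + |a'| := by linarith
  generalize |ε| + |ε'| + |a| + |a'| = m at *
  calc _ ≤ 18 * C ^ 3 * (m * |ε - ε'| + |a - a'|) + 68 * C ^ 3 * (m * |ε - ε'| + |a - a'|) := by
        gcongr
    _ = _ := by ring

/-- After division by `a`, a simplified Newton iteration with the fixed slope `γ` solves for `ε`.
The second equation then holds automatically, since the kernel component is zero. -/
theorem LocalBounds.exists_isBranch (h : sys.LocalBounds K C ρ) (hη : 0 < η) (hηρ : η ≤ ρ)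
    (hCη : 16 * C ^ 2 * η ≤ 1) (hB : sys.IsReduction K B (η / 4) η)
    (hcross : sys.SimpleCrossing) (hf0 : ∀ ε, sys.f ε 0 0 = 0) :
    ∃ e r s, 0 < r ∧ 0 < s ∧ s + r < η / 4 ∧ sys.IsBranch B e r s := by
  obtain ⟨hR0, γ, hγ, hder⟩ := hcross
  have hC := h.one_le
  have hγ' : 0 < |γ| := abs_pos.2 hγ
  obtain ⟨s₁, hs₁, hψ⟩ : ∃ s₁ > 0, ∀ ε ε' : ℝ, |ε| < s₁ → |ε'| < s₁ →
      |sys.R ε 0 0 - sys.R ε' 0 0 - γ * (ε - ε')| ≤ |γ| / 4 * |ε - ε'| := by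
    have h1 := (hasStrictDerivAt_iff_hasStrictFDerivAt.1 hder).isLittleO.def
      (show 0 < |γ| / 4 by positivity)
    obtain ⟨s₁, hs₁, h2⟩ := Metric.eventually_nhds_iff.1 h1
    refine ⟨s₁, hs₁, fun ε ε' hε hε' => ?_⟩
    have := @h2 (ε, ε') (by simp [Prod.dist_eq, hε, hε'])
    simpa [mul_comm] using this
  let P := 86 * C ^ 3
  have hP : 0 < P := by positivity
  -- The contraction constant `1/2` is shared equally: `1/4` from strict differentiability, and `4 P
  -- s / |γ| ≤ 1/4` from the remainder.
  let s := min (s₁) (min (η / 16) (|γ| / (16 * P)))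
  have hs : 0 < s := by simp only [s]; positivity
  have hsη : s ≤ η / 16 := (min_le_right _ _).trans (min_le_left _ _)
  have hsP : P * s ≤ |γ| / 16 := by
    have : s ≤ |γ| / (16 * P) := (min_le_right _ _).trans (min_le_right _ _)
    calc P * s ≤ P * (|γ| / (16 * P)) := by gcongr
      _ = |γ| / 16 := by field_simp
  let M := P / |γ|
  have hM : 0 < M := by positivity
  let r := min s (s / (4 * M))
  have hr : 0 < r := by simp only [r]; positivity
  have hrs : r ≤ s := min_le_left _ _
  have hMr : M * r ≤ s / 4 := by
    have : r ≤ s / (4 * M) := min_le_right _ _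
    calc M * r ≤ M * (s / (4 * M)) := by gcongr
      _ = s / 4 := by field_simp
  have hsmall : ∀ ε a, |ε| < s → |a| ≤ r → |ε| + |a| < η / 4 := fun ε a h1 h2 => by linarith
  let Θ : ℝ → ℝ → ℝ := fun ε a => ε - γ⁻¹ * (sys.R ε 0 0 - 1 + sys.reducedRest B ε a)
  have hB0 : B 0 0 0 = 0 := hB.2.1 0 (by simpa using hη)
  obtain ⟨e, he0, he, hlip⟩ := exists_scalar_branch Θ hr.le hs hM.le (by
    intro ε a ε' a' h1 h2 h3 h4
    have e1 := hψ ε ε' (h1.trans_le (min_le_left _ _)) (h3.trans_le (min_le_left _ _))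
    have e2 := h.reducedRest_sub_le hη hηρ hCη hB (hsmall ε a h1 h2) (hsmall ε' a' h3 h4)
    have e3 : Θ ε a - Θ ε' a' = -(γ⁻¹ * ((sys.R ε 0 0 - sys.R ε' 0 0 - γ * (ε - ε')) +
        (sys.reducedRest B ε a - sys.reducedRest B ε' a'))) := by
      simp only [Θ]; field_simp; ring
    rw [e3, abs_neg, abs_mul, abs_inv, inv_mul_le_iff₀ hγ']
    have hx := abs_nonneg (ε - ε')
    calc _ ≤ _ := abs_add_le _ _
      _ ≤ _ := add_le_add e1 e2
      _ ≤ |γ| / 4 * |ε - ε'| + P * ((4 * s) * |ε - ε'| + |a - a'|) := by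
        gcongr; linarith
      _ = |γ| / 4 * |ε - ε'| + 4 * (P * s) * |ε - ε'| + P * |a - a'| := by ring
      _ ≤ |γ| / 4 * |ε - ε'| + 4 * (|γ| / 16) * |ε - ε'| + P * |a - a'| := by gcongr
      _ = |γ| * (1 / 2 * |ε - ε'| + M * |a - a'|) := by simp only [M]; field_simp; ring)
    (by simp [Θ, hR0, reducedRest, hB0]) hMr
  have hsol : ∀ ε a, a ≠ 0 → (sys.f ε a (B ε a 0) = 0 ↔ Θ ε a = ε) := by
    intro ε a ha
    rw [f_reduction_eq ε ha]
    simp [Θ, ha, hγ]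
  refine ⟨e, r, s, hr, hs, by linarith, ⟨⟨_, hlip⟩, he0, fun a ha => (he a ha).1, fun a ha => ?_,
    fun a ha => ?_, fun a ha hne ε hε h1 _ => (he a ha).2.2 ε hε ((hsol ε a hne).1 h1)⟩⟩
  · rcases eq_or_ne a 0 with rfl | hne
    · rw [he0, hB0]; exact hf0 0
    · exact (hsol _ a hne).2 (he a ha).2.1
  · have hq : |e a| + |a| + ‖(0 : X₁)‖ < η / 4 := by
      simpa using hsmall (e a) a (he a ha).1 ha
    rw [h.g_eq_zero_iff (h.reduction_mem_paramBox hηρ hB hq)]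
    have := (hB.1 _ _ _ hq).2.1
    rw [T, zero_add] at this
    rw [this, sub_self]
    exact Submodule.zero_mem _

end DiffSystem

end Branch

/-! ### Removing the kernel component by the group action -/

section GroupAction

/-- A `C¹` parametrization of a Lie group near the identity, with derivative the identity. -/
theorem exists_chart_param (ℓ : ℕ) (G : Type*) [Group G] [TopologicalSpace G]
    [ChartedSpace (EuclideanSpace ℝ (Fin ℓ)) G] [LieGroup (𝓡 ℓ) ∞ G] :
    ∃ (Ω : Set (EuclideanSpace ℝ (Fin ℓ))) (γ : EuclideanSpace ℝ (Fin ℓ) → G),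
      IsOpen Ω ∧ 0 ∈ Ω ∧ γ 0 = 1 ∧ ContMDiffOn (𝓡 ℓ) (𝓡 ℓ) 1 γ Ω ∧
      ∀ x, derivAtZero γ x = x := by
  have : IsManifold (𝓡 ℓ) ∞ G := inferInstance
  have : IsManifold (𝓡 ℓ) 1 G := IsManifold.of_le (n := ∞) (by exact_mod_cast le_top)
  let φ := chartAt (EuclideanSpace ℝ (Fin ℓ)) (1 : G)
  let γ : EuclideanSpace ℝ (Fin ℓ) → G := fun x => φ.symm (x + φ 1)
  let Ω : Set (EuclideanSpace ℝ (Fin ℓ)) := (fun x => x + φ 1) ⁻¹' φ.target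
  have hΩ : IsOpen Ω := φ.open_target.preimage (by fun_prop)
  have h1 : (1 : G) ∈ φ.source := mem_chart_source _ _
  have h0 : 0 ∈ Ω := by simpa [Ω] using φ.map_source h1
  have hγ0 : γ 0 = 1 := by simpa [γ] using φ.left_inv h1
  have hγ : ContMDiffOn (𝓡 ℓ) (𝓡 ℓ) 1 γ Ω := by
    refine (contMDiffOn_chart_symm (I := 𝓡 ℓ) (n := 1) (x := (1 : G))).comp
      (t := φ.target) (f := fun x => x + φ 1) ?_ (fun x hx => hx)
    have : ContDiff ℝ 1 fun x : EuclideanSpace ℝ (Fin ℓ) => x + φ 1 := by fun_prop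
    exact this.contMDiff.contMDiffOn
  refine ⟨Ω, γ, hΩ, h0, hγ0, hγ, fun x => ?_⟩
  -- Read in the chart at the identity, `γ` is a translation.
  have hder : HasMFDerivAt (𝓡 ℓ) (𝓡 ℓ) γ 0
      (ContinuousLinearMap.id ℝ (EuclideanSpace ℝ (Fin ℓ))) := by
    refine ⟨hγ.continuousOn.continuousAt (hΩ.mem_nhds h0), HasFDerivAt.hasFDerivWithinAt ?_⟩
    have h2 : HasFDerivAt (fun x : EuclideanSpace ℝ (Fin ℓ) => x + φ 1)
        (ContinuousLinearMap.id ℝ (EuclideanSpace ℝ (Fin ℓ))) 0 :=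
      (hasFDerivAt_id _).add_const _
    refine h2.congr_of_eventuallyEq ?_
    filter_upwards [hΩ.mem_nhds h0] with x hx
    simp only [writtenInExtChartAt, hγ0, mfld_simps]
    exact φ.right_inv hx
  rw [derivAtZero, hder.mfderiv]
  rfl

theorem pairNorm_nonneg {X : Type*} [NormedAddCommGroup X] (p : ℝ × X) : 0 ≤ pairNorm p :=
  add_nonneg (abs_nonneg _) (norm_nonneg _)

theorem pairNorm_add_le {X : Type*} [NormedAddCommGroup X] (p q : ℝ × X) : pairNorm (p + q) ≤ pairNorm p + pairNorm q := by
  have h1 := abs_add_le p.1 q.1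
  have h2 := norm_add_le p.2 q.2
  simp only [pairNorm, Prod.fst_add, Prod.snd_add]
  linarith

theorem pairNorm_le_two_mul_norm {X : Type*} [NormedAddCommGroup X] (p : ℝ × X) : pairNorm p ≤ 2 * ‖p‖ := by
  have h1 := norm_fst_le p
  have h2 := norm_snd_le p
  rw [Real.norm_eq_abs] at h1
  simp only [pairNorm]
  linarith

theorem mem_paramBox_of_pairNorm_lt {X : Type*} [NormedAddCommGroup X] {ε ρ : ℝ} {p : ℝ × X}
    (hε : |ε| < ρ) (hp : pairNorm p < ρ) : (ε, p.1, p.2) ∈ paramBox X ρ := by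
  have h1 := abs_nonneg p.1
  have h2 := norm_nonneg p.2
  simp only [pairNorm] at hp
  exact ⟨hε, by linarith, by linarith⟩

variable {X₂ X₁ B₂ B₁ : Type*}
  [NormedAddCommGroup X₂] [NormedSpace ℝ X₂] [NormedAddCommGroup X₁] [NormedSpace ℝ X₁]
  [NormedAddCommGroup B₂] [NormedSpace ℝ B₂] [NormedAddCommGroup B₁] [NormedSpace ℝ B₁]

namespace DiffSystem

variable {E : BanachScale X₂ X₁ B₂ B₁} {sys : DiffSystem E}
  {K : ℝ → ℝ → X₁ → (X₂ →L[ℝ] X₁)} {C ρ : ℝ}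

/-- The kernel component `b - K N₂` of a pair `(a, b)`. -/
def kernelPart (sys : DiffSystem E) (K : ℝ → ℝ → X₁ → (X₂ →L[ℝ] X₁)) (ε : ℝ) (p : ℝ × X₁) : X₁ :=
  p.2 - K ε p.1 p.2 (sys.N₂ ε p.1 p.2)

/-- Continuity is obtained only in `B₁`, the norm in which differences of `K N₂` are controlled. -/
theorem LocalBounds.continuousOn_kernelPart (h : sys.LocalBounds K C ρ) {ε : ℝ} (hε : |ε| < ρ) :
    ContinuousOn (fun p => E.j (sys.kernelPart K ε p)) {p : ℝ × X₁ | pairNorm p < ρ} := by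
  have hρ := h.le
  refine (LipschitzOnWith.of_dist_le_mul (K := Real.toNNReal (1 + 4 * C ^ 2))
    fun p hp q hq => ?_).continuousOn
  rw [Real.coe_toNNReal _ (by positivity), dist_eq_norm, dist_eq_norm]
  have e1 := h.norm_K_N₂_sub_le (mem_paramBox_of_pairNorm_lt hε hp)
    (mem_paramBox_of_pairNorm_lt hε hq)
  have e2 : E.j (sys.kernelPart K ε p) - E.j (sys.kernelPart K ε q) = E.j (p.2 - q.2) -
      E.j (K ε p.1 p.2 (sys.N₂ ε p.1 p.2) - K ε q.1 q.2 (sys.N₂ ε q.1 q.2)) := by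
    simp only [kernelPart, map_sub]; abel
  have e3 : ‖E.j (p.2 - q.2)‖ ≤ ‖p - q‖ := (E.norm_j_le _).trans (norm_snd_le (p - q))
  have e4 : |p.1 - q.1| ≤ ‖p - q‖ := norm_fst_le (p - q)
  have hp' : |p.1| + ‖p.2‖ < ρ := hp
  have hq' : |q.1| + ‖q.2‖ < ρ := hq
  rw [e2]
  calc _ ≤ _ := norm_sub_le _ _
    _ ≤ _ := add_le_add e3 e1
    _ ≤ ‖p - q‖ + 2 * C ^ 2 * 1 * (|ε - ε| + ‖p - q‖ + ‖p - q‖) := by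
      gcongr
      linarith
    _ = _ := by rw [sub_self, abs_zero]; ring

theorem LocalBounds.norm_kernelPart_sub_le (h : sys.LocalBounds K C ρ) {ε : ℝ} {p : ℝ × X₁}
    (hε : |ε| < ρ) (hp : pairNorm p < ρ) :
    ‖sys.kernelPart K ε p - p.2‖ ≤ C ^ 2 * pairNorm p ^ 2 := by
  rw [kernelPart, sub_sub_cancel_left, norm_neg]
  exact h.norm_K_N₂_le (mem_paramBox_of_pairNorm_lt hε hp)

end DiffSystem

namespace GroupSymmetry

variable {E : BanachScale X₂ X₁ B₂ B₁} {sys : DiffSystem E}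
  {K : ℝ → ℝ → X₁ → (X₂ →L[ℝ] X₁)} {C ρ : ℝ} {V : Set (ℝ × ℝ × X₁)} {ℓ : ℕ} {G : Type*} [Group G]
  [TopologicalSpace G] [ChartedSpace (EuclideanSpace ℝ (Fin ℓ)) G]
  {Φ : ℝ → G → ℝ × X₁ → ℝ × X₁} {D : ℝ → (EuclideanSpace ℝ (Fin ℓ) →L[ℝ] ℝ × X₁)} {ε₁ : ℝ}

theorem exists_pairNorm_deriv_le (hG : GroupSymmetry sys V ℓ G Φ D ε₁) (hε₁ : 0 < ε₁) :
    ∃ M, 1 ≤ M ∧ ∀ ε, |ε| ≤ ε₁ → ∀ v, pairNorm (D ε v) ≤ M * ‖v‖ := by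
  obtain ⟨L, hL⟩ := hG.deriv_lipschitz
  refine ⟨max (2 * (‖D 0‖ + |L| * ε₁)) 1, le_max_right _ _, fun ε hε v => ?_⟩
  have h1 := hL ε 0 hε (by simpa using hε₁.le)
  have h2 : ‖D ε‖ ≤ ‖D 0‖ + |L| * ε₁ := by
    have h3 : ‖D ε‖ ≤ ‖D 0‖ + ‖D ε - D 0‖ := by
      simpa using norm_add_le (D 0) (D ε - D 0)
    have h4 : L * |ε - 0| ≤ |L| * ε₁ := by
      rw [sub_zero]
      exact mul_le_mul (le_abs_self L) hε (abs_nonneg _) (abs_nonneg _)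
    linarith
  calc _ ≤ 2 * ‖D ε v‖ := pairNorm_le_two_mul_norm _
    _ ≤ 2 * (‖D ε‖ * ‖v‖) := by gcongr; exact (D ε).le_opNorm v
    _ ≤ 2 * ((‖D 0‖ + |L| * ε₁) * ‖v‖) := by gcongr
    _ = 2 * (‖D 0‖ + |L| * ε₁) * ‖v‖ := by ring
    _ ≤ _ := by gcongr; exact le_max_left _ _

theorem deriv_fst_eq_zero (hG : GroupSymmetry sys V ℓ G Φ D ε₁) {ε a : ℝ} {b : X₁}
    (hε : |ε| ≤ ε₁) (hq : (ε, a, b) ∈ V) (v : EuclideanSpace ℝ (Fin ℓ)) : (D ε v).1 = 0 := by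
  have h1 : D ε v ∈ LinearMap.range (D ε).toLinearMap := ⟨v, rfl⟩
  rw [hG.range_eq ε a b hε hq] at h1
  simpa using h1.1

/-- The Lie algebra is finite-dimensional, so injectivity suffices even for the weak norm.
Continuity in `B₁` of a kernel element thus gives continuity of its Lie algebra coordinates. -/
theorem isClosedEmbedding_deriv_snd (hG : GroupSymmetry sys V ℓ G Φ D ε₁) {ε a : ℝ} {b : X₁}
    (hε : |ε| ≤ ε₁) (hq : (ε, a, b) ∈ V) : IsClosedEmbedding fun v => E.j (D ε v).2 := by
  let Λ : EuclideanSpace ℝ (Fin ℓ) →ₗ[ℝ] B₁ :=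
    (E.j.comp ((ContinuousLinearMap.snd ℝ ℝ X₁).comp (D ε))).toLinearMap
  refine LinearMap.isClosedEmbedding_of_injective (f := Λ) (LinearMap.ker_eq_bot'.2 fun v hv => ?_)
  have h2 : (D ε v).2 = 0 := E.j_injective (by simpa [Λ] using hv)
  obtain ⟨c, hc⟩ := hG.inverse_bound
  have h3 := hc ε hε v
  rw [pairNorm, hG.deriv_fst_eq_zero hε hq, h2] at h3
  simpa using h3

theorem inv_act (hG : GroupSymmetry sys V ℓ G Φ D ε₁) {ε : ℝ} (hε : |ε| ≤ ε₁) (g : G)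
    {p : ℝ × X₁} (hp : p ∈ sys.equilibria ε) : Φ ε g⁻¹ (Φ ε g p) = p := by
  rw [← hG.mul_act ε hε _ _ p hp, inv_mul_cancel, hG.one_act ε hε p hp]

/-- Where the orbit map stays small, it is continuous, not only at the identity. -/
theorem continuousAt_act [IsTopologicalGroup G] (hG : GroupSymmetry sys V ℓ G Φ D ε₁) {δ : ℝ}
    (hδ : ∀ ε, |ε| ≤ ε₁ → ∀ p ∈ sys.equilibria ε, pairNorm p < δ →
      ∃ U ∈ 𝓝 (1 : G), ContinuousOn (fun g => Φ ε g p) U)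
    {ε : ℝ} (hε : |ε| ≤ ε₁) {p : ℝ × X₁} (hp : p ∈ sys.equilibria ε) {g : G}
    (hg : pairNorm (Φ ε g p) < δ) : ContinuousAt (fun k => Φ ε k p) g := by
  obtain ⟨U, hU, hc⟩ := hδ ε hε _ (hG.mapsTo ε hε g p hp) hg
  have h1 : (fun k => Φ ε k p) = (fun k => Φ ε k (Φ ε g p)) ∘ fun k => k * g⁻¹ := by
    funext k
    rw [Function.comp_apply, ← hG.mul_act ε hε _ _ p hp, inv_mul_cancel_right]
  rw [h1]
  refine ContinuousAt.comp ?_ (continuous_mul_const g⁻¹).continuousAt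
  rw [mul_inv_cancel]
  exact hc.continuousAt hU

/-- Every small equilibrium can be moved by a group element to a small equilibrium without
kernel component. -/
theorem exists_kernelPart_eq_zero [LieGroup (𝓡 ℓ) ∞ G] (hG : GroupSymmetry sys V ℓ G Φ D ε₁)
    (hε₁ : 0 < ε₁) (h : sys.LocalBounds K C ρ) (hsub : paramBox X₁ ρ ⊆ V)
    (h00 : ∀ ε, (0, 0) ∈ sys.equilibria ε) {τ : ℝ} (hτ : 0 < τ) :
    ∃ σ > 0, ∀ ε p, |ε| + pairNorm p < σ → p ∈ sys.equilibria ε →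
      ∃ g, pairNorm (Φ ε g p) < τ ∧ sys.kernelPart K ε (Φ ε g p) = 0 := by
  have : IsTopologicalGroup G := topologicalGroup_of_lieGroup (𝓡 ℓ) ∞
  obtain ⟨Ω, γ, hΩ, hΩ0, hγ0, hγ, hγ'⟩ := exists_chart_param ℓ G
  obtain ⟨M, hM1, hM⟩ := hG.exists_pairNorm_deriv_le hε₁
  obtain ⟨c, hc1, hc⟩ : ∃ c, 1 ≤ c ∧ ∀ ε, |ε| ≤ ε₁ → ∀ v, ‖v‖ ≤ c * pairNorm (D ε v) := by
    obtain ⟨c, hc⟩ := hG.inverse_bound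
    refine ⟨max c 1, le_max_right _ _, fun ε hε v => (hc ε hε v).trans ?_⟩
    exact mul_le_mul_of_nonneg_right (le_max_left _ _) (pairNorm_nonneg _)
  obtain ⟨U, hU, δL, hδL, L, hL1, hL⟩ : ∃ U ∈ 𝓝 (1 : G), ∃ δ > 0, ∃ L : ℝ, 1 ≤ L ∧
      ∀ ε, |ε| ≤ ε₁ → ∀ g ∈ U, ∀ p ∈ sys.equilibria ε, pairNorm p < δ →
        pairNorm (Φ ε g p - Φ ε g (0, 0)) ≤ L * pairNorm p := by
    obtain ⟨U, hU, δ, hδ, L, hL⟩ := hG.lipschitz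
    refine ⟨U, hU, δ, hδ, max L 1, le_max_right _ _, fun ε hε g hg p hp hpδ => ?_⟩
    have := hL ε hε g hg p hp (0, 0) (h00 ε) hpδ (by simpa [pairNorm] using hδ)
    rw [show p - ((0, 0) : ℝ × X₁) = p from sub_zero p] at this
    exact this.trans (mul_le_mul_of_nonneg_right (le_max_left _ _) (pairNorm_nonneg _))
  obtain ⟨δc, hδc, hcont⟩ := hG.continuous
  obtain ⟨δγ, hδγ, hunif⟩ := hG.unif_deriv Ω γ hΩ hΩ0 hγ0 hγ (1 / (8 * c)) (by positivity)
  have hC := h.one_le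
  have hρ := h.pos
  obtain ⟨δΩ, hδΩ, hball⟩ : ∃ δΩ > 0, ∀ x, ‖x‖ < δΩ → x ∈ Ω ∧ γ x ∈ U := by
    have h1 : ContinuousAt γ 0 := hγ.continuousOn.continuousAt (hΩ.mem_nhds hΩ0)
    have h2 : γ ⁻¹' U ∈ 𝓝 0 := h1 (by rwa [hγ0])
    obtain ⟨δΩ, hδΩ, h3⟩ := Metric.mem_nhds_iff.1 (inter_mem (hΩ.mem_nhds hΩ0) h2)
    exact ⟨δΩ, hδΩ, fun x hx => h3 (by simpa using hx)⟩
  let N := M + 2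
  have hN : 0 < N := by simp only [N]; linarith
  obtain ⟨μ, hμ, hμτ, hμρ, hμc⟩ : ∃ μ > 0, μ ≤ τ ∧ μ ≤ ρ ∧ μ ≤ δc :=
    ⟨min τ (min ρ δc), by positivity, min_le_left _ _, (min_le_right _ _).trans (min_le_left _ _),
      (min_le_right _ _).trans (min_le_right _ _)⟩
  -- `N R` bounds the orbit of `p` over the ball of radius `R`. The last condition makes the
  -- quadratic error from `K N₂`, multiplied by the inverse bound `c`, at most `R/8`.
  obtain ⟨R, hR, hRγ, hRΩ, hRN, hRC⟩ : ∃ R > 0, R < δγ ∧ R < δΩ ∧ N * R < μ ∧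
      c * C ^ 2 * N ^ 2 * R ≤ 1 / 8 := by
    have h1 : ∀ᶠ R in 𝓝[>] (0 : ℝ), R < δγ ∧ R < δΩ ∧ N * R < μ ∧
        c * C ^ 2 * N ^ 2 * R ≤ 1 / 8 := by
      refine Filter.Eventually.filter_mono nhdsWithin_le_nhds ?_
      have t1 : Tendsto (fun R : ℝ => N * R) (𝓝 0) (𝓝 0) := by
        simpa using (continuous_const_mul N).tendsto 0
      have t2 : Tendsto (fun R : ℝ => c * C ^ 2 * N ^ 2 * R) (𝓝 0) (𝓝 0) := by
        simpa using (continuous_const_mul (c * C ^ 2 * N ^ 2)).tendsto 0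
      filter_upwards [eventually_lt_nhds hδγ, eventually_lt_nhds hδΩ,
        t1.eventually (eventually_lt_nhds hμ),
        t2.eventually (eventually_le_nhds (show (0 : ℝ) < 1 / 8 by norm_num))] with R a b d e
      exact ⟨a, b, d, e⟩
    obtain ⟨R, hR, hRpos⟩ := (h1.and self_mem_nhdsWithin).exists
    exact ⟨R, hRpos, hR⟩
  -- Replacing `p` by the origin along the orbit costs `R/(8c)`, as does linearizing at the
  -- identity. After multiplication by `c` these total `R/4`, and with `R/8` from `K N₂` they stay
  -- below `R/2`.
  refine ⟨min (min ε₁ ρ) (min δL (R / (8 * c * L))), by positivity, fun ε p hp hpe => ?_⟩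
  have hp0 := pairNorm_nonneg p
  have hε0 := abs_nonneg ε
  simp only [lt_min_iff] at hp
  obtain ⟨⟨hp1, hp2⟩, hp3, hp4⟩ := hp
  have hε : |ε| ≤ ε₁ := by linarith
  have hερ : |ε| < ρ := by linarith
  have hpL : L * pairNorm p ≤ R / (8 * c) := by
    have : pairNorm p ≤ R / (8 * c * L) := by linarith
    calc _ ≤ L * (R / (8 * c * L)) := by gcongr
      _ = _ := by field_simp
  have hcR : R / (8 * c) ≤ R := div_le_self hR.le (by linarith)
  let q : EuclideanSpace ℝ (Fin ℓ) → ℝ × X₁ := fun x => Φ ε (γ x) p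
  have hqe : ∀ x, q x ∈ sys.equilibria ε := fun x => hG.mapsTo ε hε _ p hpe
  have hqD : ∀ x, ‖x‖ ≤ R → pairNorm (q x - D ε x) ≤ R / (8 * c) + R / (8 * c) := by
    intro x hx
    have e1 := hL ε hε (γ x) (hball x (hx.trans_lt hRΩ)).2 p hpe (by linarith)
    have e2 := hunif x (hx.trans_lt hRγ) ε hε
    rw [hγ'] at e2
    have e3 : q x - D ε x = (q x - Φ ε (γ x) (0, 0)) + (Φ ε (γ x) (0, 0) - D ε x) := by abel
    have e4 : 1 / (8 * c) * ‖x‖ ≤ R / (8 * c) := by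
      rw [div_mul_eq_mul_div, one_mul]
      gcongr
    rw [e3]
    exact (pairNorm_add_le _ _).trans (add_le_add (e1.trans hpL) (e2.trans e4))
  have hqN : ∀ x, ‖x‖ ≤ R → pairNorm (q x) ≤ N * R := by
    intro x hx
    have e1 := hqD x hx
    have e2 := (hM ε hε x).trans (mul_le_mul_of_nonneg_left hx (by linarith))
    have e3 := pairNorm_add_le (q x - D ε x) (D ε x)
    rw [sub_add_cancel] at e3
    simp only [N]
    linarith
  have hqμ : ∀ x, ‖x‖ ≤ R → pairNorm (q x) < μ := fun x hx => (hqN x hx).trans_lt hRN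
  have hV : ∀ x, ‖x‖ ≤ R → (ε, (q x).1, (q x).2) ∈ paramBox X₁ ρ := fun x hx =>
    mem_paramBox_of_pairNorm_lt hερ ((hqμ x hx).trans_le hμρ)
  -- The range of `D ε` does not involve `(a,b)`, so `ker (Id - S)` is the same space at every `q
  -- x`, and a single linear map provides coordinates along the whole orbit.
  have hF : ∀ x, ∃ v, ‖x‖ ≤ R → D ε v = (0, sys.kernelPart K ε (q x)) := by
    intro x
    by_cases hx : ‖x‖ ≤ R
    swap
    · exact ⟨0, fun hc => absurd hc hx⟩
    have h1 : ((0 : ℝ), sys.kernelPart K ε (q x)) ∈ LinearMap.range (D ε).toLinearMap := by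
      rw [hG.range_eq ε _ _ hε (hsub (hV x hx))]
      exact ⟨rfl, (h.g_eq_zero_iff (hV x hx)).1 (hqe x).2⟩
    obtain ⟨v, hv⟩ := h1
    exact ⟨v, fun _ => hv⟩
  choose F hF using hF
  have hqcont : ContinuousOn q (Metric.closedBall 0 R) := by
    intro x hx
    have hx' : ‖x‖ ≤ R := by simpa using hx
    have e1 := hG.continuousAt_act hcont hε hpe ((hqμ x hx').trans_le hμc)
    have e2 : ContinuousAt γ x :=
      hγ.continuousOn.continuousAt (hΩ.mem_nhds (hball x (hx'.trans_lt hRΩ)).1)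
    exact (ContinuousAt.comp (g := fun k => Φ ε k p) e1 e2).continuousWithinAt
  have hFcont : ContinuousOn F (Metric.closedBall 0 R) := by
    have hemb := hG.isClosedEmbedding_deriv_snd hε (hsub (hV 0 (by simpa using hR.le)))
    rw [hemb.isInducing.continuousOn_iff]
    refine ((h.continuousOn_kernelPart hερ).comp hqcont fun x hx => ?_).congr fun x hx => ?_
    · exact (hqμ x (by simpa using hx)).trans_le hμρ
    · simp [hF x (by simpa using hx)]
  have hFid : ∀ x, ‖x‖ ≤ R → ‖F x - x‖ ≤ R / 2 := by
    intro x hx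
    have e1 := hc ε hε (F x - x)
    have e2 : pairNorm (D ε (F x - x)) = ‖sys.kernelPart K ε (q x) - (D ε x).2‖ := by
      rw [map_sub, hF x hx, pairNorm, Prod.fst_sub, Prod.snd_sub,
        hG.deriv_fst_eq_zero hε (hsub (hV x hx))]
      simp
    have e3 := h.norm_kernelPart_sub_le hερ ((hqμ x hx).trans_le hμρ)
    have e4 : ‖(q x).2 - (D ε x).2‖ ≤ R / (8 * c) + R / (8 * c) :=
      le_trans (le_add_of_nonneg_left (abs_nonneg _)) (hqD x hx)
    have e5 := norm_add_le (sys.kernelPart K ε (q x) - (q x).2) ((q x).2 - (D ε x).2)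
    rw [sub_add_sub_cancel] at e5
    have e6 : C ^ 2 * pairNorm (q x) ^ 2 ≤ C ^ 2 * (N * R) ^ 2 := by
      have := pairNorm_nonneg (q x)
      gcongr
      exact hqN x hx
    calc _ ≤ c * (C ^ 2 * (N * R) ^ 2 + (R / (8 * c) + R / (8 * c))) := by
          rw [e2] at e1
          refine e1.trans ?_
          gcongr
          linarith
      _ = (c * C ^ 2 * N ^ 2 * R) * R + R / 4 := by field_simp; ring
      _ ≤ 1 / 8 * R + R / 4 := by gcongr
      _ ≤ R / 2 := by linarith
  obtain ⟨x, hx, hx0⟩ := exists_zero_of_near_id F R hR hFcont hFid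
  refine ⟨γ x, (hqμ x hx).trans_le hμτ, ?_⟩
  have := hF x hx
  rw [hx0, map_zero] at this
  exact (congrArg Prod.snd this).symm

end GroupSymmetry

end GroupAction

/-! ### The main theorem -/

/-- Existence of the branch determined by `w ≡ 0`, and its uniqueness up to the group action among
the small zeros of `(f,g)`, apart from the trivial one. -/
theorem corollary2p6 {X₂ X₁ B₂ B₁ : Type*}
    [NormedAddCommGroup X₂] [NormedSpace ℝ X₂] [CompleteSpace X₂]
    [NormedAddCommGroup X₁] [NormedSpace ℝ X₁] [CompleteSpace X₁]
    [NormedAddCommGroup B₂] [NormedSpace ℝ B₂] [CompleteSpace B₂]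
    [NormedAddCommGroup B₁] [NormedSpace ℝ B₁] [CompleteSpace B₁]
    (E : BanachScale X₂ X₁ B₂ B₁) (sys : DiffSystem E)
    (V : Set (ℝ × ℝ × X₁)) (hV : V ∈ 𝓝 (0 : ℝ × ℝ × X₁)) (C : ℝ)
    (hstanding : sys.Standing V)
    (hN₁ : sys.BoundsN₁ V C) (hN₂ : sys.BoundsN₂ V C) (hR : sys.BoundsR V C)
    (hcross : sys.SimpleCrossing)
    (K : ℝ → ℝ → X₁ → (X₂ →L[ℝ] X₁))
    (hK : sys.IsRightInverse V K) (hKlip : E.RightInverseLipschitz V K C)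
    (ℓ : ℕ) {G : Type*} [Group G] [TopologicalSpace G]
    [ChartedSpace (EuclideanSpace ℝ (Fin ℓ)) G] [LieGroup (𝓡 ℓ) ∞ G]
    (Φ : ℝ → G → ℝ × X₁ → ℝ × X₁) (D : ℝ → (EuclideanSpace ℝ (Fin ℓ) →L[ℝ] ℝ × X₁))
    (ε₁ : ℝ) (hε₁ : 0 < ε₁)
    (hG : GroupSymmetry sys V ℓ G Φ D ε₁) :
    ∃ (B : ℝ → ℝ → X₁ → X₁) (e : ℝ → ℝ) (δ η r s : ℝ),
      0 < δ ∧ 0 < η ∧ 0 < r ∧ 0 < s ∧ s + r < δ ∧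
      sys.IsReduction K B δ η ∧ sys.IsBranch B e r s ∧
      ∀ τ > 0, ∃ ρ > 0, ∀ (ε a : ℝ) (b : X₁), |ε| + |a| + ‖b‖ < ρ →
        sys.f ε a b = 0 → sys.g ε a b = 0 →
          (∃ g : G, (a, b) = Φ ε g (0, 0)) ∨
          ∃ a' : ℝ, a' ≠ 0 ∧ |a'| ≤ r ∧ |a'| < τ ∧ ε = e a' ∧
            ∃ g : G, (a, b) = Φ ε g (a', B (e a') a' 0) := by
  obtain ⟨C, ρ, h, hsub⟩ := DiffSystem.exists_localBounds hV hN₁ hN₂ hR hK hKlip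
  have hC := h.one_le
  obtain ⟨η, hη, hηρ, hCη⟩ : ∃ η > 0, η ≤ ρ ∧ 16 * C ^ 2 * η ≤ 1 := by
    have := h.pos
    refine ⟨min ρ (1 / (16 * C ^ 2)), by positivity, min_le_left _ _, ?_⟩
    calc _ ≤ 16 * C ^ 2 * (1 / (16 * C ^ 2)) := by gcongr; exact min_le_right _ _
      _ = 1 := by field_simp
  obtain ⟨B, hB⟩ := h.exists_isReduction hη hηρ hCη
  obtain ⟨e, r, s, hr, hs, hrs, he⟩ := h.exists_isBranch hη hηρ hCη hB hcross hstanding.f_zero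
  refine ⟨B, e, η / 4, η, r, s, by positivity, hη, hr, hs, hrs, hB, he, fun τ hτ => ?_⟩
  have h00 : ∀ ε, (0, 0) ∈ sys.equilibria ε := fun ε => ⟨hstanding.f_zero ε, hstanding.g_zero ε⟩
  obtain ⟨σ, hσ, hgrp⟩ := hG.exists_kernelPart_eq_zero hε₁ h hsub h00
    -- The bounds `τ` and `r` place `a'` in the range of the branch, and `η/8`, together with `|ε| <
    -- η/8`, in the domain of the reduction.
    (show 0 < min (min τ r) (η / 8) by positivity)
  refine ⟨min (min σ s) (min (η / 8) ε₁), by positivity, fun ε a b hsmall hf hg => ?_⟩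
  have ha := abs_nonneg a
  have hb := norm_nonneg b
  have hε0 := abs_nonneg ε
  simp only [lt_min_iff] at hsmall
  obtain ⟨⟨h1, h2⟩, h3, h4⟩ := hsmall
  have hε : |ε| ≤ ε₁ := by linarith
  have hpe : (a, b) ∈ sys.equilibria ε := ⟨hf, hg⟩
  obtain ⟨g, hsm, hker⟩ := hgrp ε (a, b) (by simpa [pairNorm, add_assoc] using h1) hpe
  have hinv := hG.inv_act hε g hpe
  have hqe := hG.mapsTo ε hε g _ hpe
  obtain ⟨⟨a', b'⟩, hq⟩ : ∃ q, q = Φ ε g (a, b) := ⟨_, rfl⟩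
  rw [← hq] at hsm hker hinv hqe
  simp only [lt_min_iff, pairNorm] at hsm
  obtain ⟨⟨h5, h6⟩, h7⟩ := hsm
  have ha' := abs_nonneg a'
  have hb' := norm_nonneg b'
  have hq : |ε| + |a'| + ‖(0 : X₁)‖ < η / 4 := by rw [norm_zero]; linarith
  -- A vanishing kernel component is exactly the fixed point equation with `w = 0`.
  have hbB : b' = B ε a' 0 := (hB.1 ε a' 0 hq).2.2 b' (by linarith) (by
    rw [DiffSystem.T, zero_add]
    exact (sub_eq_zero.1 hker).symm)
  rcases eq_or_ne a' 0 with rfl | hne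
  · left
    rw [hB.2.1 ε (by linarith)] at hbB
    exact ⟨g⁻¹, by rw [← hbB, hinv]⟩
  · right
    have hεe : ε = e a' := he.unique a' (by linarith) hne ε (by linarith)
      (by rw [← hbB]; exact hqe.1) (by rw [← hbB]; exact hqe.2)
    refine ⟨a', hne, by linarith, by linarith, hεe, g⁻¹, ?_⟩
    rw [← hεe, ← hbB, hinv]
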